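/- All graphs and structures are finite. **Merge-width of graphs.** For a partition $\mathcal P$ of a set $V$ and a set $R\subseteq\binom V2$, the radius-$r$ width of $(\mathcal P,R)$ is the maximum, over $v\in V$, of the number of parts of $\mathcal P$ that contain a vertex at distance at most $r$ from $v$ in the graph $(V,R)$. A merge sequence of a graph $G=(V,E)$ is a sequence $(\mathcal P_1,R_1),\dots,(\mathcal P_m,R_m)$ such that: $\mathcal P_1,\dots,\mathcal P_m$ are partitions of $V$, each one equal to or coarser than the preceding one, with $\mathcal P_1$ the partition into singletons and $\mathcal P_m$ having one part (no part if $V=\emptyset$); $R_1\subseteq\dots\subseteq R_m\subseteq\binom V2$; and for all $t$ and all $X,Y\in\mathcal P_t$, the pairs $ab\notin R_t$ with $a\in X$, $b\in Y$, $a\ne b$ are either all edges or all non-edges of $G$. Its radius-$r$ width is the maximum over $2\le t\le m$ of the radius-$r$ width of $(\mathcal P_{t-1},R_t)$. The radius-$r$ merge-width $\mathrm{mw}_r(G)$ is the least radius-$r$ width of a merge sequence of $G$. A class $\mathcal C$ of graphs has bounded merge-width if $\sup_{G\in\mathcal C}\mathrm{mw}_r(G)<\infty$ for every $r\in\mathbb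 N$. **Merge-width of binary structures.** Let $\sigma=\sigma_1\cup\sigma_2$ be a finite signature of unary ($\sigma_1$) and binary ($\sigma_2$) relation symbols. The Gaifman graph of a $\sigma$-structure joins distinct $a,b$ if $R(a,b)$ or $R(b,a)$ holds for some $R\in\sigma_2$. A partitioned $\sigma$-structure is a $\sigma$-structure with additional pairwise disjoint unary predicates $P_1,P_2,\dots$, called part predicates. Its radius-$r$ width is the maximum, over its elements $a$, of the number of unary predicates (from $\sigma_1$ or part predicates) that contain an element at distance at most $r$ from $a$ in the Gaifman graph. The operations are: merging $P\neq Q$ (replace $P$ by $P\cup Q$ and $Q$ by $\emptyset$); and resolving part predicates $P,Q$ (possibly equal) by $R\in\sigma_2$ (add to $R$ all pairs in $P\times Q$ that are in no relation of $\sigma_2$). A construction sequence of a $\sigma$-structure $A$ is a sequence of partitioned $\sigma$-structures $A_1,\dots,A_m$ such that the Gaifman graph of $A_1$ is edgeless and all its part predicates have at most one element; each $A_{t+1}$ is obtained from $A_t$ by one operation; at most one part predicate of $A_m$ is nonempty; and $A$ is obtained from $A_m$ by forgetting the part predicates. Its radius-$r$ width is the maximum of the radius-$r$ widths of $A_1,\dots,A_m$,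 and $\mathrm{mw}_r(A)$ is the least radius-$r$ width of a construction sequence of $A$ ($\infty$ if there is none). For a structure $A$ with domain $V$ and a first-order formula $\varphi(x,y)$, let $\varphi(A)$ be the graph with vertex set $V$ and edge set $\{ab\in\binom V2 : A\models\varphi(a,b)\}$, so that $ab$ is an edge if and only if $\varphi(a,b)$ or $\varphi(b,a)$ holds in $A$. Let $\rho(k,0)=1$ and $\rho(k,q)=(13^k+1)\,\rho(k+1,q-1)$ for $q>0$. A class $\mathcal C$ of graphs transduces a class $\mathcal D$ of graphs if there is a first-order formula $\varphi(x,y)$ involving the edge relation and additional unary relation symbols such that every $H\in\mathcal D$ is, up to isomorphism, obtained from some $G\in\mathcal C$ by expanding $G$ arbitrarily by the unary relations, which gives a structure $G'$, and taking the subgraph of $\varphi(G')$ induced by some set $W\subseteq V(G)$. **Theorem.** 1. If $\varphi(x,y)$ is a first-order formula and $\mathcal C$ is a class of graphs of bounded merge-width, then $\{\varphi(G):G\in\mathcal C\}$ has bounded merge-width. 2. For every finite signature $\sigma$ of unary and binary relation symbols there is a function $f_\sigma:\mathbb N^2\to\mathbb N$ such that for all $q,r,n\in\mathbb N$, every $\sigma$-structure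 $A$ and every first-order $\sigma$-formula $\varphi(x,y)$ of quantifier rank at most $q$: if $\mathrm{mw}_{r(\rho(2,q)+1)}(A)\le n$, then $\mathrm{mw}_r(\varphi(A))\le f_\sigma(q,n)$. 3. If a class $\mathcal C$ of graphs transduces a class $\mathcal D$ of graphs and $\mathcal C$ has bounded merge-width, then so does $\mathcal D$. -/

import Mathlib

universe u v w

namespace MergeWidth

/-! ### Merge-width of graphs -/

/-- The parts of the partition `P` that are reachable from `x` by a path of length at most `r`
in the graph `R`. A partition of `V` is given by its equivalence relation. -/
def reachableParts {V : Type u} (P : Setoid V) (R : SimpleGraph V) (r : ℕ) (x : V) :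
    Set (Set V) :=
  {S | S ∈ P.classes ∧ ∃ a ∈ S, R.edist x a ≤ r}

/-- The radius-`r` width of a pair `(P, R)` of a partition `P` of `V` and a set `R` of pairs of
distinct elements of `V` (given as a graph): the maximum number of parts reachable from a vertex. -/
noncomputable def pairWidth {V : Type u} (P : Setoid V) (R : SimpleGraph V) (r : ℕ) : ℕ∞ :=
  ⨆ x : V, (reachableParts P R r x).encard

/-- A merge sequence `(P 0, R 0), …, (P m, R m)` of a graph `G`.
Partitions are ordered by coarsening: `⊥` is the partition into singletons, and `⊤` is the
partition with one part (with no part if there is no vertex). -/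
structure MergeSequence {V : Type u} (G : SimpleGraph V) where
  m : ℕ
  P : Fin (m + 1) → Setoid V
  R : Fin (m + 1) → SimpleGraph V
  P_first : P 0 = ⊥
  P_last : P (Fin.last m) = ⊤
  P_mono : Monotone P
  R_mono : Monotone R
  homogeneous : ∀ t, ∀ S ∈ (P t).classes, ∀ T ∈ (P t).classes,
    (∀ a ∈ S, ∀ b ∈ T, a ≠ b → ¬ (R t).Adj a b → G.Adj a b) ∨
    (∀ a ∈ S, ∀ b ∈ T, a ≠ b → ¬ (R t).Adj a b → ¬ G.Adj a b)

/-- The radius-`r` width of a merge sequence: the maximum radius-`r` width of the pairs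
`(P t, R (t + 1))`. -/
noncomputable def MergeSequence.width {V : Type u} {G : SimpleGraph V} (S : MergeSequence G)
    (r : ℕ) : ℕ∞ :=
  ⨆ t : Fin S.m, pairWidth (S.P t.castSucc) (S.R t.succ) r

/-- The radius-`r` merge-width of a graph: the least radius-`r` width of a merge sequence. -/
noncomputable def mergeWidth {V : Type u} (G : SimpleGraph V) (r : ℕ) : ℕ∞ :=
  ⨅ S : MergeSequence G, S.width r

/-- Finite graphs. -/
structure FiniteGraph where
  V : Type u
  [finite : Finite V]
  graph : SimpleGraph V

/-- A class of finite graphs has bounded merge-width if for each `r` the radius-`r` merge-width is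
bounded on the class. -/
def BoundedMergeWidth (C : Set FiniteGraph.{u}) : Prop :=
  ∀ r : ℕ, ⨆ G ∈ C, mergeWidth G.graph r < ⊤

/-! ### First-order formulas and interpretations -/

/-- The quantifier rank of a first-order formula. -/
def quantifierRank {L : FirstOrder.Language.{v, w}} {α : Type u} : {n : ℕ} → L.BoundedFormula α n → ℕ
  | _, .falsum => 0
  | _, .equal _ _ => 0
  | _, .rel _ _ => 0
  | _, .imp f g => max (quantifierRank f) (quantifierRank g)
  | _, .all f => quantifierRank f + 1

/-- The graph `φ(A)` with the same vertices as the structure `A`, and with edges the pairs `{a, b}`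
of distinct elements such that `A ⊨ φ(a, b)` (for one of the two orders of the pair). -/
def interpret {L : FirstOrder.Language.{v, w}} {V : Type u} (A : L.Structure V) (φ : L.Formula (Fin 2)) :
    SimpleGraph V :=
  SimpleGraph.fromRel fun a b => @FirstOrder.Language.Formula.Realize L V A (Fin 2) φ ![a, b]

/-- The class `{φ(G) : G ∈ C}`. -/
def interpretClass (φ : FirstOrder.Language.graph.Formula (Fin 2)) (C : Set FiniteGraph.{u}) :
    Set FiniteGraph.{u} :=
  {H | ∃ G ∈ C, H = { V := G.V, finite := G.finite, graph := interpret G.graph.structure φ }}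

/-! ### Binary structures -/

/-- The symbols of a binary signature with unary symbols `U` and binary symbols `B`. -/
inductive BinaryRel (U B : Type v) : ℕ → Type v
  | unary : U → BinaryRel U B 1
  | binary : B → BinaryRel U B 2

/-- The binary relational language with unary symbols `U` and binary symbols `B`. -/
def binaryLanguage (U B : Type v) : FirstOrder.Language.{0, v} := ⟨fun _ => Empty, BinaryRel U B⟩

/-- Structures with domain `V` over the binary signature with unary symbols `U` and binary
symbols `B`. -/
structure BinaryStructure (U B : Type v) (V : Type u) where
  unary : U → Set V
  binary : B → V → V → Prop

namespace BinaryStructure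

variable {U B : Type v} {V : Type u}

/-- A binary structure as a first-order structure. -/
@[reducible]
def toStructure (A : BinaryStructure U B V) : (binaryLanguage U B).Structure V where
  funMap := fun f => nomatch f
  RelMap
    | .unary Y => fun x => x 0 ∈ A.unary Y
    | .binary R => fun x => A.binary R (x 0) (x 1)

/-- The Gaifman graph. -/
def gaifman (A : BinaryStructure U B V) : SimpleGraph V :=
  SimpleGraph.fromRel fun a b => ∃ R, A.binary R a b

end BinaryStructure

/-- A partitioned structure: a binary structure with additional pairwise disjoint unary predicates
`part 0, part 1, …`, called the part predicates. -/
structure PartitionedStructure (U B : Type v) (V : Type u) extends BinaryStructure U B V where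
  part : ℕ → Set V
  part_disjoint : ∀ i j, i ≠ j → Disjoint (part i) (part j)

namespace PartitionedStructure

variable {U B : Type v} {V : Type u}

/-- The interpretation of the unary predicates of a partitioned structure. -/
def predicate (A : PartitionedStructure U B V) : U ⊕ ℕ → Set V :=
  Sum.elim A.unary A.part

/-- The unary predicates that are reachable from `a` by a path of length at most `r` in the Gaifman
graph. -/
def reach (A : PartitionedStructure U B V) (r : ℕ) (a : V) : Set (U ⊕ ℕ) :=
  {Y | ∃ b ∈ A.predicate Y, A.gaifman.edist a b ≤ r}

/-- The radius-`r` width of a partitioned structure. -/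
noncomputable def width (A : PartitionedStructure U B V) (r : ℕ) : ℕ∞ :=
  ⨆ a : V, (A.reach r a).encard

/-- The operation of adding to the binary relation `R` all pairs in `part i × part j` that are not
in any binary relation. -/
def resolve (A : PartitionedStructure U B V) (R : B) (i j : ℕ) : PartitionedStructure U B V where
  unary := A.unary
  binary S a b := A.binary S a b ∨ (S = R ∧ a ∈ A.part i ∧ b ∈ A.part j ∧ ∀ T, ¬ A.binary T a b)
  part := A.part
  part_disjoint := A.part_disjoint

/-- The operation of replacing `part i` by `part i ∪ part j`, and `part j` by the empty set
(used for `i ≠ j`). -/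
def merge (A : PartitionedStructure U B V) (i j : ℕ) : PartitionedStructure U B V where
  unary := A.unary
  binary := A.binary
  part k := if k = i then A.part i ∪ A.part j else if k = j then ∅ else A.part k
  part_disjoint k l hkl := by
    simp only [Set.disjoint_left]
    have h : ∀ k l, k ≠ l → ∀ x ∈ A.part k, x ∉ A.part l :=
      fun k l hkl _ hx => Set.disjoint_left.mp (A.part_disjoint k l hkl) hx
    grind

/-- A partitioned structure is initial if its Gaifman graph is edgeless and all part predicates
contain at most one element. -/
def IsInitial (A : PartitionedStructure U B V) : Prop :=
  A.gaifman = ⊥ ∧ ∀ i, (A.part i).Subsingleton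

/-- `A'` results from `A` by one merge or resolve operation. -/
def Step (A A' : PartitionedStructure U B V) : Prop :=
  (∃ i j : ℕ, i ≠ j ∧ A' = A.merge i j) ∨ ∃ (R : B) (i j : ℕ), A' = A.resolve R i j

end PartitionedStructure

/-- A construction sequence `str 0, …, str m` for a binary structure `A`. -/
structure ConstructionSequence {U B : Type v} {V : Type u} (A : BinaryStructure U B V) where
  m : ℕ
  str : Fin (m + 1) → PartitionedStructure U B V
  initial : (str 0).IsInitial
  step : ∀ t : Fin m, (str t.castSucc).Step (str t.succ)
  one_part : ∃ i, ∀ j, j ≠ i → (str (Fin.last m)).part j = ∅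
  reduct : (str (Fin.last m)).toBinaryStructure = A

/-- The radius-`r` width of a construction sequence. -/
noncomputable def ConstructionSequence.width {U B : Type v} {V : Type u}
    {A : BinaryStructure U B V} (S : ConstructionSequence A) (r : ℕ) : ℕ∞ :=
  ⨆ t, (S.str t).width r

/-- The radius-`r` merge-width of a binary structure: the least radius-`r` width of a construction
sequence, and `⊤` if there is no construction sequence. -/
noncomputable def BinaryStructure.mergeWidth {U B : Type v} {V : Type u}
    (A : BinaryStructure U B V) (r : ℕ) : ℕ∞ :=
  ⨅ S : ConstructionSequence A, S.width r

/-- The function `ρ`. -/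
def rho : ℕ → ℕ → ℕ
  | _, 0 => 1
  | k, q + 1 => (13 ^ k + 1) * rho (k + 1) q

/-! ### Transductions -/

/-- The expansion of a graph by unary relations `Y 0, …, Y (k - 1)`. The only binary symbol is
interpreted as adjacency. -/
def expansion {V : Type u} (G : SimpleGraph V) {k : ℕ} (Y : Fin k → Set V) :
    BinaryStructure (Fin k) Unit V where
  unary := Y
  binary _ := G.Adj

/-- `C` transduces `D`: for some formula `φ(x, y)` involving the edge relation and additional unary
relation symbols, every graph in `D` is obtained (up to isomorphism) from some graph `G` in `C` by
expanding `G` by unary relations, applying `φ`, and restricting to a set `W` of vertices. -/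
def Transduces (C : Set FiniteGraph.{u}) (D : Set FiniteGraph.{v}) : Prop :=
  ∃ (k : ℕ) (φ : (binaryLanguage (Fin k) Unit).Formula (Fin 2)), ∀ H ∈ D, ∃ G ∈ C,
    ∃ (Y : Fin k → Set G.V) (W : Set G.V),
      Nonempty (H.graph ≃g (interpret (expansion G.graph Y).toStructure φ).induce W)

end MergeWidth

open MergeWidth

/-!
The heart of the proof is the second part; it concerns a construction sequence `A 0, …, A m` of a
structure, and a formula of quantifier rank at most `q`.

Consider an Ehrenfeucht-Fraïssé game with `q` rounds on the structure `A t` with its part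
predicates. A position is a set of pairs of corresponding elements, which have to agree on unary
predicates, binary relations, and truncated distances to each other and to all parts. The structure
has unboundedly many parts, but only few of them near each vertex. There are two versions of the
game: in the local one, each new element is played near an element played before, and in the
unrestricted one it may also be played anywhere. They are related as follows.

* Locality (`GameEquiv.sUnion`): if Duplicator wins the local game from several positions that are
  far apart on both sides, then Duplicator wins the unrestricted game from their union. When Spoiler
  plays an element far from all others, an answer far from all others is found by a pigeonhole
  argument (`exists_far_answer`).
* Monotonicity (`GameEquiv.step`): a position that Duplicator wins in the unrestricted game at time
  `t` is still won at time `t + 1`. Indeed the pairs connected by a resolve operation are determined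
  by the parts, so that new distances are determined by old distances to parts.
* Counting (`exists_localType`): the number of types of elements for the local game is bounded in
  terms of the number of parts nearby.

Let two elements be equivalent at time `t` if Duplicator wins the unrestricted game on `A t` from
the pair that they form. By monotonicity, the classes become coarser with time; by locality and
counting, only a bounded number of them is near each vertex; and by locality, for elements at a
distance larger than `sep 2 q` the truth of the formula only depends on their classes. Hence these
partitions form a merge sequence of the interpreted graph, in which the pairs at distance at most
`sep 2 q` are resolved (`mergeWidth_interpret_le`).

For the other two parts, a merge sequence of a graph is turned into a construction sequence of the
same width, up to a constant, for the structure with relations for adjacency and for non-adjacency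
(`mergeWidth_fullExpansion_le`). From time `t` to `t + 1`, a pair of parts is resolved if all its
unresolved pairs of elements belong to `R (t + 1)`; in the remaining pairs of parts, the
unresolved pairs of elements have the same kind as the pairs outside of `R (t + 1)`, so that the
parts can be merged. Then the second part applies, and merge-width does not increase when passing to
induced subgraphs (`mergeWidth_le_of_embedding`).
-/

namespace MergeWidth

/-! ### Bounded distance in graphs -/

section Within

variable {V : Type u}

/-- `Within G m a b` says that `a` and `b` are at distance at most `m` in `G`. -/
def Within (G : SimpleGraph V) (m : ℕ) (a b : V) : Prop :=
  G.edist a b ≤ m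

theorem Within.refl (G : SimpleGraph V) (m : ℕ) (a : V) : Within G m a a := by
  simp [Within]

theorem Within.symm {G : SimpleGraph V} {m : ℕ} {a b : V} (h : Within G m a b) :
    Within G m b a := by
  rwa [Within, SimpleGraph.edist_comm]

theorem Within.trans {G : SimpleGraph V} {m n : ℕ} {a b c : V} (h : Within G m a b)
    (h' : Within G n b c) : Within G (m + n) a c := by
  unfold Within at *
  push_cast
  exact SimpleGraph.edist_triangle.trans (add_le_add h h')

theorem Within.mono {G : SimpleGraph V} {m n : ℕ} {a b : V} (h : Within G m a b) (hmn : m ≤ n) :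
    Within G n a b :=
  le_trans h (by exact_mod_cast hmn)

theorem Within.mono_graph {G H : SimpleGraph V} {m : ℕ} {a b : V} (h : Within G m a b)
    (hGH : G ≤ H) : Within H m a b :=
  (SimpleGraph.edist_anti hGH).trans h

theorem within_zero {G : SimpleGraph V} {a b : V} : Within G 0 a b ↔ a = b := by
  simp [Within]

theorem within_one {G : SimpleGraph V} {a b : V} : Within G 1 a b ↔ G.Adj a b ∨ a = b := by
  simpa [Within] using SimpleGraph.edist_le_one_iff_adj_or_eq

theorem Within.of_adj {G : SimpleGraph V} {a b : V} (h : G.Adj a b) : Within G 1 a b :=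
  within_one.2 (Or.inl h)

theorem within_bot {m : ℕ} {a b : V} : Within (⊥ : SimpleGraph V) m a b ↔ a = b := by
  refine ⟨fun h => ?_, fun h => h ▸ Within.refl _ _ _⟩
  have hne : (⊥ : SimpleGraph V).edist a b ≠ ⊤ :=
    ne_top_of_le_ne_top (ENat.natCast_ne_top m) h
  obtain ⟨p, -⟩ := SimpleGraph.exists_walk_of_edist_ne_top hne
  cases p with
  | nil => rfl
  | cons h _ => exact absurd h (by simp)

theorem Within.exists_walk {G : SimpleGraph V} {m : ℕ} {a b : V} (h : Within G m a b) :
    ∃ p : G.Walk a b, p.length ≤ m := by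
  obtain ⟨p, hp⟩ := SimpleGraph.exists_walk_of_edist_ne_top
    (ne_top_of_le_ne_top (ENat.natCast_ne_top m) h)
  refine ⟨p, ?_⟩
  unfold Within at h
  rw [← hp] at h
  exact_mod_cast h

/-- Induction along the edges of a shortest path, starting from a fixed vertex. -/
theorem Within.rec_adj {G : SimpleGraph V} {a : V} {C : ℕ → V → Prop} (zero : C 0 a)
    (mono : ∀ m n b, m ≤ n → C m b → C n b)
    (step : ∀ m b c, C m b → G.Adj b c → C (m + 1) c) {m : ℕ} {b : V} (h : Within G m a b) :
    C m b := by
  obtain ⟨p, hp⟩ := h.exists_walk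
  refine mono _ _ _ hp ?_
  clear hp h
  induction p using SimpleGraph.Walk.concatRec with
  | Hnil => exact zero
  | Hconcat p h ih =>
    rw [SimpleGraph.Walk.length_concat]
    exact step _ _ _ (ih zero) h

/-- If each edge of `G` joins vertices at distance at most `s` in `H`, then distances grow by a
factor of at most `s`. -/
theorem Within.of_edges {G H : SimpleGraph V} {s : ℕ} (hGH : ∀ a b, G.Adj a b → Within H s a b)
    {m : ℕ} {a b : V} (h : Within G m a b) : Within H (m * s) a b := by
  refine h.rec_adj (C := fun m b => Within H (m * s) a b) (Within.refl _ _ _) ?_ ?_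
  · intro m n b hmn h
    exact h.mono (Nat.mul_le_mul_right _ hmn)
  · intro m b c h hbc
    exact (h.trans (hGH _ _ hbc)).mono (by rw [Nat.succ_mul])

end Within

/-! ### The game -/

/-- The distance `sep k q` beyond which two groups of elements, of `k` elements in total, do not
interact within `q` rounds of the game. In the choice of representatives among `k` elements, a
distance is multiplied by `5` up to `k - 1` times, and another factor of `3` is lost afterwards. -/
def sep : ℕ → ℕ → ℕ
  | _, 0 => 1
  | k, q + 1 => (5 ^ k + 1) * sep (k + 1) q

/-- The radius of the local moves when `k` elements have been played and `q` further rounds follow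
the current one. -/
def localRadius (k q : ℕ) : ℕ :=
  5 ^ k * sep (k + 1) q

theorem sep_succ (k q : ℕ) : sep k (q + 1) = localRadius k q + sep (k + 1) q := by
  rw [sep, localRadius, Nat.add_mul, one_mul]

theorem sep_pos (k q : ℕ) : 1 ≤ sep k q := by
  induction q generalizing k with
  | zero => exact le_rfl
  | succ q ih =>
    have := ih (k + 1)
    rw [sep_succ]; omega

theorem sep_le_localRadius (k q : ℕ) : sep (k + 1) q ≤ localRadius k q :=
  Nat.le_mul_of_pos_left _ (by positivity)

theorem sep_succ_le (k q : ℕ) : sep (k + 1) q ≤ sep k (q + 1) := by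
  rw [sep_succ]; omega

theorem localRadius_succ_le (k q : ℕ) : localRadius (k + 1) q ≤ localRadius k (q + 1) := by
  rw [localRadius, localRadius, sep]
  have h : 5 ^ (k + 1) ≤ 5 ^ k * (5 ^ (k + 1) + 1) :=
    (Nat.le_succ _).trans (Nat.le_mul_of_pos_left _ (by positivity))
  calc 5 ^ (k + 1) * sep (k + 1 + 1) q ≤ 5 ^ k * (5 ^ (k + 1) + 1) * sep (k + 1 + 1) q :=
        Nat.mul_le_mul_right _ h
    _ = _ := by ring

namespace PartitionedStructure

variable {U B : Type v} {V : Type u}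

/-- The part `l` contains an element at distance at most `m` from `a`. -/
def Near (A : PartitionedStructure U B V) (m : ℕ) (a : V) (l : ℕ) : Prop :=
  ∃ b ∈ A.part l, Within A.gaifman m a b

theorem Near.mono {A : PartitionedStructure U B V} {m n : ℕ} {a : V} {l : ℕ} (h : A.Near m a l)
    (hmn : m ≤ n) : A.Near n a l :=
  let ⟨b, hb, hab⟩ := h
  ⟨b, hb, hab.mono hmn⟩

theorem near_zero {A : PartitionedStructure U B V} {a : V} {l : ℕ} :
    A.Near 0 a l ↔ a ∈ A.part l := by
  simp [Near, within_zero]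

/-- A set `Z` of pairs preserves, from left to right, the unary predicates, the distances to the
parts up to `Λ`, the binary relations, and the mutual distances up to `M`. -/
structure Preserves (A : PartitionedStructure U B V) (Λ M : ℕ) (Z : Set (V × V)) : Prop where
  unary : ∀ p ∈ Z, ∀ Y, p.1 ∈ A.unary Y → p.2 ∈ A.unary Y
  near : ∀ p ∈ Z, ∀ l, ∀ m ≤ Λ, A.Near m p.1 l → A.Near m p.2 l
  binary : ∀ p ∈ Z, ∀ p' ∈ Z, ∀ R, A.binary R p.1 p'.1 → A.binary R p.2 p'.2
  within : ∀ p ∈ Z, ∀ p' ∈ Z, ∀ m ≤ M, Within A.gaifman m p.1 p'.1 → Within A.gaifman m p.2 p'.2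

/-- Each move on the left-hand side has an answer on the right-hand side that leads to a position
with property `X`. A local move plays an element at distance at most `m ≤ ℓ` from an element played
before, and its answer has to respect this bound. A global move is unrestricted; it is available if
`g` holds. -/
def Forth (A : PartitionedStructure U B V) (g : Prop) (ℓ : ℕ) (X : Set (V × V) → Prop)
    (Z : Set (V × V)) : Prop :=
  (g → ∀ c, ∃ d, X (insert (c, d) Z)) ∧
    ∀ p ∈ Z, ∀ m ≤ ℓ, ∀ c, Within A.gaifman m p.1 c →
      ∃ d, Within A.gaifman m p.2 d ∧ X (insert (c, d) Z)

/-- Duplicator wins the `q`-round Ehrenfeucht-Fraïssé game from the position `Z`, a set of at most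
`k` pairs of corresponding elements. Local moves are always available, and global moves if `g`
holds. -/
def GameEquiv (A : PartitionedStructure U B V) (Λ : ℕ) (g : Prop) :
    ℕ → ℕ → Set (V × V) → Prop
  | 0, k, Z => A.Preserves Λ (sep k 0) Z ∧ A.Preserves Λ (sep k 0) (Prod.swap ⁻¹' Z)
  | q + 1, k, Z =>
    (A.Preserves Λ (sep k (q + 1)) Z ∧
      A.Forth g (localRadius k q) (A.GameEquiv Λ g q (k + 1)) Z) ∧
    (A.Preserves Λ (sep k (q + 1)) (Prod.swap ⁻¹' Z) ∧
      A.Forth g (localRadius k q) (A.GameEquiv Λ g q (k + 1)) (Prod.swap ⁻¹' Z))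

variable {A : PartitionedStructure U B V} {Λ M : ℕ} {g g' : Prop} {q k ℓ : ℕ}
  {X X' : Set (V × V) → Prop} {Z Z' : Set (V × V)}

theorem Preserves.mono (h : A.Preserves Λ M Z) {M' : ℕ} (hM : M' ≤ M) (hZ : Z' ⊆ Z) :
    A.Preserves Λ M' Z' where
  unary p hp := h.unary p (hZ hp)
  near p hp := h.near p (hZ hp)
  binary p hp p' hp' := h.binary p (hZ hp) p' (hZ hp')
  within p hp p' hp' m hm := h.within p (hZ hp) p' (hZ hp') m (hm.trans hM)

theorem Forth.mono (h : A.Forth g ℓ X Z) {ℓ' : ℕ} (hg : g' → g) (hℓ : ℓ' ≤ ℓ) (hZ : Z' ⊆ Z)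
    (hX : ∀ p, X (insert p Z) → X' (insert p Z')) : A.Forth g' ℓ' X' Z' := by
  refine ⟨fun hg' c => ?_, fun p hp m hm c hc => ?_⟩
  · obtain ⟨d, hd⟩ := h.1 (hg hg') c
    exact ⟨d, hX _ hd⟩
  · obtain ⟨d, hd, hd'⟩ := h.2 p (hZ hp) m (hm.trans hℓ) c hc
    exact ⟨d, hd, hX _ hd'⟩

namespace GameEquiv

theorem symm (h : A.GameEquiv Λ g q k Z) : A.GameEquiv Λ g q k (Prod.swap ⁻¹' Z) := by
  cases q with
  | zero => exact And.symm h
  | succ q => exact And.symm h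

theorem preserves (h : A.GameEquiv Λ g q k Z) : A.Preserves Λ (sep k q) Z := by
  cases q with
  | zero => exact h.1
  | succ q => exact h.1.1

theorem preserves_swap (h : A.GameEquiv Λ g q k Z) :
    A.Preserves Λ (sep k q) (Prod.swap ⁻¹' Z) :=
  h.symm.preserves

theorem mono (h : A.GameEquiv Λ g q k Z) (hg : g' → g) (hZ : Z' ⊆ Z) :
    A.GameEquiv Λ g' q k Z' := by
  induction q generalizing k Z Z' with
  | zero => exact ⟨h.1.mono le_rfl hZ, h.2.mono le_rfl (Set.preimage_mono hZ)⟩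
  | succ q ih =>
    have key : ∀ {Z Z' : Set (V × V)}, Z' ⊆ Z →
        A.Forth g (localRadius k q) (A.GameEquiv Λ g q (k + 1)) Z →
        A.Forth g' (localRadius k q) (A.GameEquiv Λ g' q (k + 1)) Z' :=
      fun hZ h => h.mono hg le_rfl hZ fun p hp => ih hp (Set.insert_subset_insert hZ)
    exact ⟨⟨h.1.1.mono le_rfl hZ, key hZ h.1.2⟩,
      ⟨h.2.1.mono le_rfl (Set.preimage_mono hZ), key (Set.preimage_mono hZ) h.2.2⟩⟩

/-- A position that is won for `q + 1` further rounds is won for `q` further rounds. -/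
theorem weaken (h : A.GameEquiv Λ g (q + 1) k Z) : A.GameEquiv Λ g q (k + 1) Z := by
  induction q generalizing k Z with
  | zero =>
    exact ⟨h.preserves.mono (sep_succ_le _ _) le_rfl,
      h.preserves_swap.mono (sep_succ_le _ _) le_rfl⟩
  | succ q ih =>
    exact ⟨⟨h.preserves.mono (sep_succ_le _ _) le_rfl,
        h.1.2.mono id (localRadius_succ_le _ _) le_rfl fun p => ih⟩,
      ⟨h.preserves_swap.mono (sep_succ_le _ _) le_rfl,
        h.2.2.mono id (localRadius_succ_le _ _) le_rfl fun p => ih⟩⟩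

theorem of_diagonal (hZ : ∀ p ∈ Z, p.1 = p.2) : A.GameEquiv Λ g q k Z := by
  have pres : ∀ {M} {Z : Set (V × V)}, (∀ p ∈ Z, p.1 = p.2) → A.Preserves Λ M Z := by
    intro M Z hZ
    refine ⟨fun p hp => ?_, fun p hp => ?_, fun p hp p' hp' => ?_, fun p hp p' hp' => ?_⟩
    · simp [hZ p hp]
    · simp [hZ p hp]
    · simp [hZ p hp, hZ p' hp']
    · simp [hZ p hp, hZ p' hp']
  have hsw : ∀ p ∈ Prod.swap ⁻¹' Z, p.1 = p.2 := fun p hp => (hZ _ hp).symm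
  induction q generalizing k Z with
  | zero => exact ⟨pres hZ, pres hsw⟩
  | succ q ih =>
    have key : ∀ {Z : Set (V × V)}, (∀ p ∈ Z, p.1 = p.2) →
        A.Forth g (localRadius k q) (A.GameEquiv Λ g q (k + 1)) Z := by
      intro Z hZ
      have ins : ∀ c, A.GameEquiv Λ g q (k + 1) (insert (c, c) Z) := by
        intro c
        have : ∀ p ∈ insert (c, c) Z, p.1 = p.2 := by
          rintro p (rfl | hp)
          exacts [rfl, hZ p hp]
        exact ih this fun p hp => (this _ hp).symm
      refine ⟨fun _ c => ⟨c, ins c⟩, fun p hp m _ c hc => ⟨c, ?_, ins c⟩⟩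
      rwa [← hZ p hp]
    exact ⟨⟨pres hZ, key hZ⟩, ⟨pres hsw, key hsw⟩⟩

/-- The composition of two positions won by Duplicator is won by Duplicator. -/
theorem comp (h : A.GameEquiv Λ g q k Z) (h' : A.GameEquiv Λ g q k Z') :
    A.GameEquiv Λ g q k {p | ∃ y, (p.1, y) ∈ Z ∧ (y, p.2) ∈ Z'} := by
  have pres : ∀ {M} {Z Z' : Set (V × V)}, A.Preserves Λ M Z → A.Preserves Λ M Z' →
      A.Preserves Λ M {p | ∃ y, (p.1, y) ∈ Z ∧ (y, p.2) ∈ Z'} := by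
    intro M Z Z' h h'
    refine ⟨?_, ?_, ?_, ?_⟩
    · rintro p ⟨y, hy, hy'⟩ Y hp
      exact h'.unary _ hy' _ (h.unary _ hy _ hp)
    · rintro p ⟨y, hy, hy'⟩ l m hm hp
      exact h'.near _ hy' _ _ hm (h.near _ hy _ _ hm hp)
    · rintro p ⟨y, hy, hy'⟩ p' ⟨z, hz, hz'⟩ R hp
      exact h'.binary _ hy' _ hz' _ (h.binary _ hy _ hz _ hp)
    · rintro p ⟨y, hy, hy'⟩ p' ⟨z, hz, hz'⟩ m hm hp
      exact h'.within _ hy' _ hz' _ hm (h.within _ hy _ hz _ hm hp)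
  have hsw : ∀ Z Z' : Set (V × V), Prod.swap ⁻¹' {p : V × V | ∃ y, (p.1, y) ∈ Z ∧ (y, p.2) ∈ Z'} =
      {p | ∃ y, (p.1, y) ∈ Prod.swap ⁻¹' Z' ∧ (y, p.2) ∈ Prod.swap ⁻¹' Z} := by
    intro Z Z'
    ext p
    exact exists_congr fun y => and_comm
  induction q generalizing k Z Z' with
  | zero =>
    refine ⟨pres h.1 h'.1, ?_⟩
    rw [hsw]
    exact pres h'.2 h.2
  | succ q ih =>
    have key : ∀ {Z Z' : Set (V × V)},
        A.Forth g (localRadius k q) (A.GameEquiv Λ g q (k + 1)) Z →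
        A.Forth g (localRadius k q) (A.GameEquiv Λ g q (k + 1)) Z' →
        A.Forth g (localRadius k q) (A.GameEquiv Λ g q (k + 1))
          {p | ∃ y, (p.1, y) ∈ Z ∧ (y, p.2) ∈ Z'} := by
      intro Z Z' h h'
      have ins : ∀ c d e : V, insert (c, e) {p : V × V | ∃ y, (p.1, y) ∈ Z ∧ (y, p.2) ∈ Z'} ⊆
          {p | ∃ y, (p.1, y) ∈ insert (c, d) Z ∧ (y, p.2) ∈ insert (d, e) Z'} := by
        rintro c d e p (rfl | ⟨y, hy, hy'⟩)
        · exact ⟨d, Or.inl rfl, Or.inl rfl⟩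
        · exact ⟨y, Or.inr hy, Or.inr hy'⟩
      refine ⟨fun hg c => ?_, ?_⟩
      · obtain ⟨d, hd⟩ := h.1 hg c
        obtain ⟨e, he⟩ := h'.1 hg d
        exact ⟨e, (ih hd he).mono id (ins c d e)⟩
      · rintro p ⟨y, hy, hy'⟩ m hm c hc
        obtain ⟨d, hd, hd'⟩ := h.2 _ hy m hm c hc
        obtain ⟨e, he, he'⟩ := h'.2 _ hy' m hm d hd
        exact ⟨e, he, (ih hd' he').mono id (ins c d e)⟩
    refine ⟨⟨pres h.1.1 h'.1.1, key h.1.2 h'.1.2⟩, ?_⟩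
    rw [hsw]
    exact ⟨pres h'.2.1 h.2.1, key h'.2.2 h.2.2⟩

theorem symm_singleton {x y : V} (h : A.GameEquiv Λ g q k {(x, y)}) :
    A.GameEquiv Λ g q k {(y, x)} := by
  refine h.symm.mono id ?_
  rintro p rfl
  rfl

theorem trans_singleton {x y z : V} (h : A.GameEquiv Λ g q k {(x, y)})
    (h' : A.GameEquiv Λ g q k {(y, z)}) : A.GameEquiv Λ g q k {(x, z)} := by
  refine (h.comp h').mono id ?_
  rintro p rfl
  exact ⟨y, rfl, rfl⟩

/-- Local moves on the right-hand side have answers on the left-hand side. -/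
theorem back (h : A.GameEquiv Λ g (q + 1) k Z) {p : V × V} (hp : p ∈ Z) {m : ℕ}
    (hm : m ≤ localRadius k q) {d : V} (hd : Within A.gaifman m p.2 d) :
    ∃ c, Within A.gaifman m p.1 c ∧ A.GameEquiv Λ g q (k + 1) (insert (c, d) Z) := by
  obtain ⟨c, hc, hc'⟩ := h.2.2.2 p.swap (by simpa using hp) m hm d hd
  refine ⟨c, hc, hc'.symm.mono id ?_⟩
  rintro p (rfl | hp)
  · exact Or.inl rfl
  · exact Or.inr (by simpa using hp)

end GameEquiv

end PartitionedStructure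

/-! ### Locality of the game -/

namespace PartitionedStructure

variable {U B : Type v} {V : Type u} {A : PartitionedStructure U B V} {Λ : ℕ} {q k : ℕ}

/-- Every set of pairs that preserves distances up to `M` has a subset `I` of representatives and
a scale `σ'` such that the representatives are far apart on the left-hand side, and all pairs are
close to a representative on the right-hand side, by a margin of `ρ`. If two representatives are
too close, one of them is dropped and the scale is multiplied by `5`. -/
theorem exists_scale {Γ : SimpleGraph V} {Z : Set (V × V)} {M ρ : ℕ}
    (hM : ∀ p ∈ Z, ∀ p' ∈ Z, ∀ m ≤ M, Within Γ m p.1 p'.1 → Within Γ m p.2 p'.2) (n : ℕ)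
    (I : Finset (V × V)) (hI : (I : Set (V × V)) ⊆ Z) (hn : I.card ≤ n + 1) (σ : ℕ) (hρ : ρ ≤ σ)
    (hσ : 5 ^ n * σ ≤ M)
    (cover : ∀ p ∈ Z, ∃ p' ∈ I, Within Γ (σ - ρ) p.2 p'.2) :
    ∃ J : Finset (V × V), ∃ σ', (J : Set (V × V)) ⊆ Z ∧ ρ ≤ σ' ∧ σ' ≤ 5 ^ n * σ ∧
      (∀ p ∈ Z, ∃ p' ∈ J, Within Γ (σ' - ρ) p.2 p'.2) ∧
      ∀ p ∈ J, ∀ p' ∈ J, Within Γ (4 * σ') p.1 p'.1 → p = p' := by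
  classical
  induction n generalizing I σ with
  | zero =>
    refine ⟨I, σ, hI, hρ, by simp, cover, fun p hp p' hp' _ => ?_⟩
    exact Finset.card_le_one.1 (by simpa using hn) p hp p' hp'
  | succ n ih =>
    by_cases hsep : ∀ p ∈ I, ∀ p' ∈ I, Within Γ (4 * σ) p.1 p'.1 → p = p'
    · exact ⟨I, σ, hI, hρ, Nat.le_mul_of_pos_left _ (by positivity), cover, hsep⟩
    push Not at hsep
    obtain ⟨p, hp, p', hp', hpp', hne⟩ := hsep
    have h5 : 5 ^ (n + 1) * σ = 5 ^ n * (5 * σ) := by ring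
    have h4 : 4 * σ ≤ M := by
      refine le_trans ?_ hσ
      rw [h5]
      exact (Nat.mul_le_mul_right _ (by norm_num)).trans (Nat.le_mul_of_pos_left _ (by positivity))
    have hclose := hM p (hI hp) p' (hI hp') _ h4 hpp'
    rw [h5]
    refine ih (I.erase p) (fun x hx => hI (Finset.mem_of_mem_erase hx)) ?_ (5 * σ) (by omega)
      (by rwa [← h5]) ?_
    · rw [Finset.card_erase_of_mem hp]; omega
    · intro x hx
      obtain ⟨y, hy, hxy⟩ := cover x hx
      by_cases hyp : y = p
      · subst hyp
        exact ⟨p', Finset.mem_erase.2 ⟨hne.symm, hp'⟩, (hxy.trans hclose).mono (by omega)⟩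
      · exact ⟨y, Finset.mem_erase.2 ⟨hyp, hy⟩, hxy.mono (by omega)⟩

/-- A family `𝒞` of positions is separated if elements of different positions are at distance
greater than `M`, on both sides. -/
def Separated (A : PartitionedStructure U B V) (M : ℕ) (𝒞 : Set (Set (V × V))) : Prop :=
  ∀ C ∈ 𝒞, ∀ D ∈ 𝒞, C ≠ D → ∀ p ∈ C, ∀ p' ∈ D,
    ¬ Within A.gaifman M p.1 p'.1 ∧ ¬ Within A.gaifman M p.2 p'.2

theorem not_binary_of_not_within {a b : V} (h : ¬ Within A.gaifman 1 a b) (R : B) :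
    ¬ A.binary R a b := by
  intro hR
  rw [within_one] at h
  push Not at h
  exact h.1 ((SimpleGraph.fromRel_adj _ _ _).2 ⟨h.2, Or.inl ⟨R, hR⟩⟩)

theorem Preserves.sUnion {𝒞 : Set (Set (V × V))} {M : ℕ} (hM : 1 ≤ M)
    (h : ∀ C ∈ 𝒞, A.Preserves Λ M C) (hsep : A.Separated M 𝒞) : A.Preserves Λ M (⋃₀ 𝒞) where
  unary := by
    rintro p ⟨C, hC, hp⟩
    exact (h C hC).unary p hp
  near := by
    rintro p ⟨C, hC, hp⟩
    exact (h C hC).near p hp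
  binary := by
    rintro p ⟨C, hC, hp⟩ p' ⟨D, hD, hp'⟩ R hR
    by_cases hCD : C = D
    · subst hCD
      exact (h C hC).binary p hp p' hp' R hR
    · exact absurd hR (not_binary_of_not_within
        (fun h => (hsep C hC D hD hCD p hp p' hp').1 (h.mono hM)) R)
  within := by
    rintro p ⟨C, hC, hp⟩ p' ⟨D, hD, hp'⟩ m hm hpp'
    by_cases hCD : C = D
    · subst hCD
      exact (h C hC).within p hp p' hp' m hm hpp'
    · exact absurd (hpp'.mono hm) (hsep C hC D hD hCD p hp p' hp').1

/-- Duplicator can answer a move that is far from all elements played before by an element that is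
far from all elements played before. Otherwise all elements that are locally equivalent to `c` are
close to the right-hand side. Let `J` be the set of representatives with an element locally
equivalent to `c` nearby; it does not matter on which side, by the local moves. Choosing such an
element near the left-hand side of each representative, and a representative with right-hand side
near this element, gives an injective map from `J` to `J`. It is therefore surjective, so that the
element `c` is also close to the left-hand side. -/
theorem exists_far_answer {𝒞 : Set (Set (V × V))}
    (h : ∀ C ∈ 𝒞, A.GameEquiv Λ False (q + 1) k C) (hsep : A.Separated (sep k (q + 1)) 𝒞)
    (hfin : (⋃₀ 𝒞).Finite) (hcard : (⋃₀ 𝒞).ncard ≤ k) {c : V}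
    (hc : ∀ p ∈ ⋃₀ 𝒞, ¬ Within A.gaifman (localRadius k q) p.1 c) :
    ∃ d, (∀ p ∈ ⋃₀ 𝒞, ¬ Within A.gaifman (sep (k + 1) q) p.2 d) ∧
      A.GameEquiv Λ False q (k + 1) {(c, d)} := by
  classical
  by_contra! hno
  have hcc : A.GameEquiv Λ False q (k + 1) {(c, c)} :=
    GameEquiv.of_diagonal (by rintro p rfl; rfl)
  have hclose : ∀ e, A.GameEquiv Λ False q (k + 1) {(c, e)} →
      ∃ p ∈ ⋃₀ 𝒞, Within A.gaifman (sep (k + 1) q) p.2 e := by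
    intro e he
    by_contra! hne
    exact hno e hne he
  have hpres : A.Preserves Λ (sep k (q + 1)) (⋃₀ 𝒞) :=
    Preserves.sUnion (sep_pos _ _) (fun C hC => (h C hC).preserves) hsep
  have hcard' : hfin.toFinset.card = (⋃₀ 𝒞).ncard := (Set.ncard_eq_toFinset_card _ hfin).symm
  have hk : 1 ≤ k := by
    obtain ⟨p, hp, -⟩ := hclose c hcc
    exact le_trans ((Set.ncard_pos hfin).2 ⟨p, hp⟩) hcard
  have h5 : 5 * 5 ^ (k - 1) = 5 ^ k := by
    rw [← pow_succ']; congr 1; omega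
  obtain ⟨I, σ, hI, hρσ, hσ, cover, hsepI⟩ := exists_scale hpres.within (k - 1)
    hfin.toFinset (by simp) (by omega) (sep (k + 1) q) le_rfl
    (by rw [sep]; exact Nat.mul_le_mul_right _ (by omega))
    (fun p hp => ⟨p, by simpa using hp, Within.refl _ _ _⟩)
  have h3σ : 3 * σ ≤ localRadius k q := by
    rw [localRadius, ← h5]
    calc 3 * σ ≤ 5 * (5 ^ (k - 1) * sep (k + 1) q) := Nat.mul_le_mul (by norm_num) hσ
      _ = _ := by ring
  let J := I.filter fun p => ∃ e, Within A.gaifman σ p.1 e ∧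
    A.GameEquiv Λ False q (k + 1) {(c, e)}
  have hJ : ∀ e, A.GameEquiv Λ False q (k + 1) {(c, e)} →
      ∃ p ∈ J, Within A.gaifman σ p.2 e := by
    intro e he
    obtain ⟨p, hp, hpe⟩ := hclose e he
    obtain ⟨p', hp', hpp'⟩ := cover p hp
    have hp'e : Within A.gaifman σ p'.2 e := (hpp'.symm.trans hpe).mono (by omega)
    obtain ⟨C, hC, hp'C⟩ := hI hp'
    obtain ⟨e', he', hee'⟩ := (h C hC).back hp'C (by omega : σ ≤ localRadius k q) hp'e
    refine ⟨p', Finset.mem_filter.2 ⟨hp', e', he', ?_⟩, hp'e⟩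
    exact he.trans_singleton (hee'.mono id (by simp)).symm_singleton
  have hchoice : ∀ p : J, ∃ p' : J, ∃ e, Within A.gaifman σ p.1.1 e ∧
      Within A.gaifman σ p'.1.2 e := by
    rintro ⟨p, hp⟩
    obtain ⟨e, hpe, he⟩ := (Finset.mem_filter.1 hp).2
    obtain ⟨p', hp', hp'e⟩ := hJ e he
    exact ⟨⟨p', hp'⟩, e, hpe, hp'e⟩
  choose f e hfe hfe' using hchoice
  have hf : Function.Injective f := by
    intro p₁ p₂ h12
    apply Subtype.ext
    refine hsepI _ (Finset.mem_filter.1 p₁.2).1 _ (Finset.mem_filter.1 p₂.2).1 ?_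
    have h1 := (hfe p₁).trans (hfe' p₁).symm
    rw [h12] at h1
    exact (h1.trans ((hfe' p₂).trans (hfe p₂).symm)).mono (by omega)
  obtain ⟨p, hp, hpc⟩ := hJ c hcc
  obtain ⟨p', hp'⟩ := (Finite.injective_iff_surjective.1 hf) ⟨p, hp⟩
  refine hc p'.1 (hI (Finset.mem_filter.1 p'.2).1) ?_
  have h1 := hfe' p'
  rw [hp'] at h1
  exact ((hfe p').trans (h1.symm.trans hpc)).mono (by omega)

theorem Separated.mono {𝒞 : Set (Set (V × V))} {M M' : ℕ} (h : A.Separated M 𝒞) (hM : M' ≤ M) :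
    A.Separated M' 𝒞 :=
  fun C hC D hD hCD p hp p' hp' =>
    ⟨fun hw => (h C hC D hD hCD p hp p' hp').1 (hw.mono hM),
      fun hw => (h C hC D hD hCD p hp p' hp').2 (hw.mono hM)⟩

/-- Adding a position that is far from all positions in a separated family. -/
theorem Separated.insert {𝒞 : Set (Set (V × V))} {M : ℕ} (h : A.Separated M 𝒞) {D : Set (V × V)}
    (hD : ∀ C ∈ 𝒞, ∀ p ∈ C, ∀ p' ∈ D,
      ¬ Within A.gaifman M p.1 p'.1 ∧ ¬ Within A.gaifman M p.2 p'.2) :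
    A.Separated M (insert D 𝒞) := by
  rintro C₁ (rfl | hC₁) C₂ (rfl | hC₂) hne p hp p' hp'
  · exact absurd rfl hne
  · exact ⟨fun hw => (hD _ hC₂ p' hp' p hp).1 hw.symm, fun hw => (hD _ hC₂ p' hp' p hp).2 hw.symm⟩
  · exact hD _ hC₁ p hp p' hp'
  · exact h _ hC₁ _ hC₂ hne p hp p' hp'

theorem Separated.swap {𝒞 : Set (Set (V × V))} {M : ℕ} (h : A.Separated M 𝒞) :
    A.Separated M ((Prod.swap ⁻¹' ·) '' 𝒞) := by
  rintro _ ⟨C, hC, rfl⟩ _ ⟨D, hD, rfl⟩ hne p hp p' hp'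
  exact (h C hC D hD (fun h => hne (h ▸ rfl)) _ hp _ hp').symm

/-- Locality of the game: if Duplicator wins the local game from each position in a family, and
these positions are far from each other, then Duplicator wins the unrestricted game from their
union. -/
theorem GameEquiv.sUnion {𝒞 : Set (Set (V × V))} (h : ∀ C ∈ 𝒞, A.GameEquiv Λ False q k C)
    (hsep : A.Separated (sep k q) 𝒞) (hfin : (⋃₀ 𝒞).Finite) (hcard : (⋃₀ 𝒞).ncard ≤ k) :
    A.GameEquiv Λ True q k (⋃₀ 𝒞) := by
  have hswap : ∀ 𝒞 : Set (Set (V × V)), Prod.swap ⁻¹' (⋃₀ 𝒞) = ⋃₀ ((Prod.swap ⁻¹' ·) '' 𝒞) := by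
    intro 𝒞
    rw [Set.sUnion_image, Set.sUnion_eq_biUnion, Set.preimage_iUnion₂]
  have hsymm : ∀ {q k} {𝒞 : Set (Set (V × V))}, (∀ C ∈ 𝒞, A.GameEquiv Λ False q k C) →
      ∀ C ∈ (Prod.swap ⁻¹' ·) '' 𝒞, A.GameEquiv Λ False q k C := by
    rintro q k 𝒞 h _ ⟨C, hC, rfl⟩
    exact (h C hC).symm
  induction q generalizing k 𝒞 with
  | zero =>
    refine ⟨Preserves.sUnion le_rfl (fun C hC => (h C hC).preserves) hsep, ?_⟩
    rw [hswap]
    exact Preserves.sUnion le_rfl (fun C hC => (hsymm h C hC).preserves) hsep.swap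
  | succ q ih =>
    have key : ∀ 𝒞 : Set (Set (V × V)), (∀ C ∈ 𝒞, A.GameEquiv Λ False (q + 1) k C) →
        A.Separated (sep k (q + 1)) 𝒞 → (⋃₀ 𝒞).Finite → (⋃₀ 𝒞).ncard ≤ k →
        A.Forth True (localRadius k q) (A.GameEquiv Λ True q (k + 1)) (⋃₀ 𝒞) := by
      intro 𝒞 h hsep hfin hcard
      have hins : ∀ p : V × V, (insert p (⋃₀ 𝒞)).Finite ∧ (insert p (⋃₀ 𝒞)).ncard ≤ k + 1 :=
        fun p => ⟨hfin.insert p, (Set.ncard_insert_le _ _).trans (by omega)⟩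
      have hlocal : ∀ p ∈ ⋃₀ 𝒞, ∀ m ≤ localRadius k q, ∀ c, Within A.gaifman m p.1 c →
          ∃ d, Within A.gaifman m p.2 d ∧
            A.GameEquiv Λ True q (k + 1) (insert (c, d) (⋃₀ 𝒞)) := by
        rintro p ⟨C, hC, hp⟩ m hm c hc
        obtain ⟨d, hd, hcd⟩ := (h C hC).1.2.2 p hp m hm c hc
        refine ⟨d, hd, ?_⟩
        have hunion : insert (c, d) (⋃₀ 𝒞) = ⋃₀ (insert (insert (c, d) C) (𝒞 \ {C})) := by
          rw [Set.sUnion_insert, Set.insert_union, ← Set.sUnion_insert, Set.insert_sdiff_singleton,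
            Set.insert_eq_of_mem hC]
        have hfar : ∀ D ∈ 𝒞 \ {C}, ∀ p' ∈ D, ∀ p'' ∈ insert (c, d) C,
            ¬ Within A.gaifman (sep (k + 1) q) p'.1 p''.1 ∧
            ¬ Within A.gaifman (sep (k + 1) q) p'.2 p''.2 := by
          rintro D ⟨hD, hDC⟩ p' hp' p'' (rfl | hp'')
          · have := hsep D hD C hC hDC p' hp' p hp
            have hle : sep (k + 1) q + m ≤ sep k (q + 1) := by rw [sep_succ]; omega
            exact ⟨fun hw => this.1 ((hw.trans hc.symm).mono hle),
              fun hw => this.2 ((hw.trans hd.symm).mono hle)⟩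
          · exact hsep.mono (sep_succ_le _ _) D hD C hC hDC p' hp' p'' hp''
        have hi := hins (c, d)
        rw [hunion] at hi ⊢
        refine ih ?_ ?_ hi.1 hi.2
        · rintro D (rfl | hD)
          · exact hcd
          · exact (h D hD.1).weaken
        · refine Separated.insert (fun D hD E hE => ?_) hfar
          exact hsep.mono (sep_succ_le _ _) D hD.1 E hE.1
      refine ⟨fun _ c => ?_, hlocal⟩
      by_cases hc : ∃ p ∈ ⋃₀ 𝒞, Within A.gaifman (localRadius k q) p.1 c
      · obtain ⟨p, hp, hpc⟩ := hc
        obtain ⟨d, -, hd⟩ := hlocal p hp _ le_rfl c hpc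
        exact ⟨d, hd⟩
      push Not at hc
      obtain ⟨d, hd, hcd⟩ := exists_far_answer h hsep hfin hcard hc
      refine ⟨d, ?_⟩
      have hi := hins (c, d)
      have hunion : insert (c, d) (⋃₀ 𝒞) = ⋃₀ (insert {(c, d)} 𝒞) := by
        rw [Set.sUnion_insert, Set.singleton_union]
      rw [hunion] at hi ⊢
      refine ih ?_ ?_ hi.1 hi.2
      · rintro D (rfl | hD)
        · exact hcd
        · exact (h D hD).weaken
      · refine Separated.insert (hsep.mono (sep_succ_le _ _)) ?_
        rintro C hC p hp p' rfl
        exact ⟨fun hw => hc p ⟨C, hC, hp⟩ (hw.mono (sep_le_localRadius _ _)),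
          hd p ⟨C, hC, hp⟩⟩
    refine ⟨⟨Preserves.sUnion (sep_pos _ _) (fun C hC => (h C hC).preserves) hsep,
      key 𝒞 h hsep hfin hcard⟩, ?_⟩
    have hfin' : (Prod.swap ⁻¹' (⋃₀ 𝒞)).Finite := hfin.preimage Prod.swap_injective.injOn
    have hcard' : (Prod.swap ⁻¹' (⋃₀ 𝒞)).ncard ≤ k := by
      rwa [Set.ncard_preimage_of_injective_subset_range Prod.swap_injective fun p _ =>
        ⟨p.swap, by simp⟩]
    rw [hswap] at hfin' hcard' ⊢
    exact ⟨Preserves.sUnion (sep_pos _ _) (fun C hC => (hsymm h C hC).preserves) hsep.swap,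
      key _ (hsymm h) hsep.swap hfin' hcard'⟩

end PartitionedStructure

/-! ### Monotonicity along a construction sequence -/

namespace PartitionedStructure

variable {U B : Type v} {V : Type u} {A A' : PartitionedStructure U B V} {Λ : ℕ} {q k : ℕ}

theorem gaifman_adj (A : PartitionedStructure U B V) {a b : V} :
    A.gaifman.Adj a b ↔ a ≠ b ∧ ∃ R, A.binary R a b ∨ A.binary R b a := by
  rw [BinaryStructure.gaifman, SimpleGraph.fromRel_adj]
  simp only [exists_or]

theorem gaifman_le_resolve (A : PartitionedStructure U B V) (R : B) (i j : ℕ) :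
    A.gaifman ≤ (A.resolve R i j).gaifman := by
  intro a b h
  rw [gaifman_adj] at h ⊢
  obtain ⟨hab, S, h⟩ := h
  exact ⟨hab, S, h.imp Or.inl Or.inl⟩

/-- After resolving two parts, all their elements are adjacent or equal. -/
theorem within_resolve (A : PartitionedStructure U B V) (R : B) {i j : ℕ} {a b : V}
    (ha : a ∈ A.part i) (hb : b ∈ A.part j) : Within (A.resolve R i j).gaifman 1 a b := by
  rw [within_one]
  by_cases hab : a = b
  · exact Or.inr hab
  refine Or.inl ((gaifman_adj _).2 ⟨hab, ?_⟩)
  by_cases h : ∃ T, A.binary T a b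
  · obtain ⟨T, hT⟩ := h
    exact ⟨T, Or.inl (Or.inl hT)⟩
  · exact ⟨R, Or.inl (Or.inr ⟨rfl, ha, hb, fun T hT => h ⟨T, hT⟩⟩)⟩

theorem resolve_gaifman_adj {R : B} {i j : ℕ} {a b : V} (h : (A.resolve R i j).gaifman.Adj a b) :
    A.gaifman.Adj a b ∨ (a ∈ A.part i ∧ b ∈ A.part j) ∨ (b ∈ A.part i ∧ a ∈ A.part j) := by
  rw [gaifman_adj] at h
  obtain ⟨hab, S, (h | ⟨-, ha, hb, -⟩) | (h | ⟨-, ha, hb, -⟩)⟩ := h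
  · exact Or.inl ((gaifman_adj _).2 ⟨hab, S, Or.inl h⟩)
  · exact Or.inr (Or.inl ⟨ha, hb⟩)
  · exact Or.inl ((gaifman_adj _).2 ⟨hab, S, Or.inr h⟩)
  · exact Or.inr (Or.inr ⟨ha, hb⟩)

/-- A short path after a resolve operation is either a path before this operation, or it can be
replaced by a path from one end to some part `S` before the operation, a path from some part `T` to
the other end before the operation, and a path between arbitrary elements of `S` and `T`. -/
theorem resolve_within_cases {R : B} {i j m : ℕ} {a b : V}
    (h : Within (A.resolve R i j).gaifman m a b) :
    Within A.gaifman m a b ∨ ∃ S T m₁ s m₂, m₁ + s + 1 + m₂ ≤ m ∧ A.Near m₁ a S ∧ A.Near m₂ b T ∧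
      ∀ x ∈ A.part S, ∀ y ∈ A.part T, Within (A.resolve R i j).gaifman (s + 1) x y := by
  refine h.rec_adj (C := fun m b => Within A.gaifman m a b ∨ ∃ S T m₁ s m₂, m₁ + s + 1 + m₂ ≤ m ∧
    A.Near m₁ a S ∧ A.Near m₂ b T ∧
      ∀ x ∈ A.part S, ∀ y ∈ A.part T, Within (A.resolve R i j).gaifman (s + 1) x y)
    (Or.inl (Within.refl _ _ _)) ?_ ?_
  · rintro m n b hmn (h | ⟨S, T, m₁, s, m₂, hm, h⟩)
    · exact Or.inl (h.mono hmn)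
    · exact Or.inr ⟨S, T, m₁, s, m₂, hm.trans hmn, h⟩
  · intro m b c h hbc
    -- A new edge from a part `X` to a part `Y` that contains its end.
    have new : ∀ X Y, b ∈ A.part X → c ∈ A.part Y →
        (∀ x ∈ A.part X, ∀ y ∈ A.part Y, Within (A.resolve R i j).gaifman 1 x y) →
        ∃ S T m₁ s m₂, m₁ + s + 1 + m₂ ≤ m + 1 ∧ A.Near m₁ a S ∧ A.Near m₂ c T ∧
        ∀ x ∈ A.part S, ∀ y ∈ A.part T, Within (A.resolve R i j).gaifman (s + 1) x y := by
      intro X Y hb hc hXY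
      rcases h with h | ⟨S, T, m₁, s, m₂, hm, ha, ⟨w, hw, hbw⟩, hST⟩
      · exact ⟨X, Y, m, 0, 0, by omega, ⟨b, hb, h⟩, near_zero.2 hc, hXY⟩
      · refine ⟨S, Y, m₁, s + 1 + m₂, 0, by omega, ha, near_zero.2 hc, fun x hx y hy => ?_⟩
        have hwb := hbw.symm.mono_graph (gaifman_le_resolve A R i j)
        exact ((hST x hx w hw).trans hwb).trans (hXY b hb y hy)
    rcases resolve_gaifman_adj hbc with hbc | ⟨hb, hc⟩ | ⟨hc, hb⟩
    · rcases h with h | ⟨S, T, m₁, s, m₂, hm, ha, ⟨w, hw, hbw⟩, hST⟩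
      · exact Or.inl (h.trans (Within.of_adj hbc))
      · exact Or.inr ⟨S, T, m₁, s, m₂ + 1, by omega, ha,
          ⟨w, hw, ((Within.of_adj hbc).symm.trans hbw).mono (by omega)⟩, hST⟩
    · exact Or.inr (new i j hb hc fun x hx y hy => within_resolve A R hx hy)
    · exact Or.inr (new j i hb hc fun x hx y hy => (within_resolve A R hy hx).symm)

theorem resolve_within_transfer {R : B} {i j m : ℕ} {a b a' b' : V}
    (ha : ∀ l, ∀ n < m, A.Near n a l → A.Near n a' l)
    (hb : ∀ l, ∀ n < m, A.Near n b l → A.Near n b' l)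
    (hab : Within A.gaifman m a b → Within A.gaifman m a' b')
    (h : Within (A.resolve R i j).gaifman m a b) : Within (A.resolve R i j).gaifman m a' b' := by
  rcases resolve_within_cases h with h | ⟨S, T, m₁, s, m₂, hm, hS, hT, hST⟩
  · exact (hab h).mono_graph (gaifman_le_resolve A R i j)
  · obtain ⟨x, hx, hax⟩ := ha S m₁ (by omega) hS
    obtain ⟨y, hy, hby⟩ := hb T m₂ (by omega) hT
    exact (((hax.mono_graph (gaifman_le_resolve A R i j)).trans (hST x hx y hy)).trans
      (hby.symm.mono_graph (gaifman_le_resolve A R i j))).mono (by omega)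

theorem resolve_near_transfer {R : B} {i j m l : ℕ} {a a' : V}
    (ha : ∀ l, ∀ n ≤ m, A.Near n a l → A.Near n a' l)
    (h : (A.resolve R i j).Near m a l) : (A.resolve R i j).Near m a' l := by
  obtain ⟨b, hb, hab⟩ := h
  rcases resolve_within_cases hab with h | ⟨S, T, m₁, s, m₂, hm, hS, ⟨y, hy, hby⟩, hST⟩
  · obtain ⟨c, hc, hac⟩ := ha l m le_rfl ⟨b, hb, h⟩
    exact ⟨c, hc, hac.mono_graph (gaifman_le_resolve A R i j)⟩
  · obtain ⟨x, hx, hax⟩ := ha S m₁ (by omega) hS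
    exact ⟨b, hb, (((hax.mono_graph (gaifman_le_resolve A R i j)).trans (hST x hx y hy)).trans
      (hby.symm.mono_graph (gaifman_le_resolve A R i j))).mono (by omega)⟩

theorem mem_part_iff_of_preserves {M : ℕ} {Z : Set (V × V)} (h : A.Preserves Λ M Z)
    {p : V × V} (hp : p ∈ Z) {l : ℕ} (hl : p.1 ∈ A.part l) : p.2 ∈ A.part l :=
  near_zero.1 (h.near p hp l 0 (Nat.zero_le _) (near_zero.2 hl))

theorem Preserves.resolve {M : ℕ} {Z : Set (V × V)} (hM : M ≤ Λ + 1) (h : A.Preserves Λ M Z)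
    (h' : A.Preserves Λ M (Prod.swap ⁻¹' Z)) (R : B) (i j : ℕ) :
    (A.resolve R i j).Preserves Λ M Z where
  unary := h.unary
  near p hp l m hm := resolve_near_transfer fun l n hn => h.near p hp l n (hn.trans hm)
  binary := by
    rintro p hp p' hp' S (hS | ⟨hS, hi, hj, hno⟩)
    · exact Or.inl (h.binary p hp p' hp' S hS)
    · exact Or.inr ⟨hS, mem_part_iff_of_preserves h hp hi, mem_part_iff_of_preserves h hp' hj,
        fun T hT => hno T (h'.binary p.swap (by simpa) p'.swap (by simpa) T hT)⟩
  within p hp p' hp' m hm :=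
    resolve_within_transfer (fun l n hn => h.near p hp l n (by omega))
      (fun l n hn => h.near p' hp' l n (by omega)) (h.within p hp p' hp' m hm)

theorem near_merge {i j m l : ℕ} {a : V} :
    (A.merge i j).Near m a l ↔
      if l = i then A.Near m a i ∨ A.Near m a j else l ≠ j ∧ A.Near m a l := by
  have hpart : (A.merge i j).part l =
      if l = i then A.part i ∪ A.part j else if l = j then ∅ else A.part l := rfl
  have hg : (A.merge i j).gaifman = A.gaifman := rfl
  simp only [Near, hg, hpart]
  split_ifs with h1 h2
  · simp only [Set.mem_union, or_and_right, exists_or]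
  · simp [h2]
  · simp [h2]

theorem Preserves.merge {M : ℕ} {Z : Set (V × V)} (h : A.Preserves Λ M Z) (i j : ℕ) :
    (A.merge i j).Preserves Λ M Z where
  unary := h.unary
  near p hp l m hm := by
    rw [near_merge, near_merge]
    split_ifs
    · exact Or.imp (h.near p hp i m hm) (h.near p hp j m hm)
    · exact And.imp_right (h.near p hp l m hm)
  binary := h.binary
  within := h.within

theorem Preserves.step {M : ℕ} {Z : Set (V × V)} (hM : M ≤ Λ + 1) (h : A.Preserves Λ M Z)
    (h' : A.Preserves Λ M (Prod.swap ⁻¹' Z)) (hstep : A.Step A') : A'.Preserves Λ M Z := by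
  rcases hstep with ⟨i, j, -, rfl⟩ | ⟨R, i, j, rfl⟩
  · exact h.merge i j
  · exact h.resolve hM h' R i j

/-- Each step of a construction sequence preserves winning positions of the unrestricted game. A
local move that is not local before a resolve operation is answered by a global move: by the
distances to the parts, the answer is local after the operation. Since a new path uses a new edge,
only distances to parts below its length matter, whence the bound on `Λ`. -/
theorem GameEquiv.step {Z : Set (V × V)} (hΛ : sep k q ≤ Λ + 1) (h : A.GameEquiv Λ True q k Z)
    (hstep : A.Step A') : A'.GameEquiv Λ True q k Z := by
  induction q generalizing k Z with
  | zero =>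
    exact ⟨h.preserves.step hΛ h.preserves_swap hstep, h.preserves_swap.step hΛ h.preserves hstep⟩
  | succ q ih =>
    have hle := sep_succ k q
    have hpos := sep_pos (k + 1) q
    have key : ∀ {Z : Set (V × V)},
        A.Forth True (localRadius k q) (A.GameEquiv Λ True q (k + 1)) Z →
        A'.Forth True (localRadius k q) (A'.GameEquiv Λ True q (k + 1)) Z := by
      intro Z h
      refine ⟨fun _ c => ?_, fun p hp m hm c hc => ?_⟩
      · obtain ⟨d, hd⟩ := h.1 trivial c
        exact ⟨d, ih (by omega) hd⟩
      by_cases hcA : Within A.gaifman m p.1 c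
      · obtain ⟨d, hd, hcd⟩ := h.2 p hp m hm c hcA
        refine ⟨d, ?_, ih (by omega) hcd⟩
        rcases hstep with ⟨i, j, -, rfl⟩ | ⟨R, i, j, rfl⟩
        · exact hd
        · exact hd.mono_graph (gaifman_le_resolve A R i j)
      · obtain ⟨d, hcd⟩ := h.1 trivial c
        refine ⟨d, ?_, ih (by omega) hcd⟩
        rcases hstep with ⟨i, j, -, rfl⟩ | ⟨R, i, j, rfl⟩
        · exact absurd hc hcA
        · have hpres := hcd.preserves
          exact resolve_within_transfer
            (fun l n hn => hpres.near p (Or.inr hp) l n (by omega))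
            (fun l n hn => hpres.near (c, d) (Or.inl rfl) l n (by omega))
            (fun h => absurd h hcA) hc
    exact ⟨⟨h.preserves.step hΛ h.preserves_swap hstep, key h.1.2⟩,
      ⟨h.preserves_swap.step hΛ h.preserves hstep, key h.2.2⟩⟩

end PartitionedStructure

/-! ### Counting local types -/

namespace PartitionedStructure

variable {U B : Type v} {V : Type u} {A : PartitionedStructure U B V} {Λ : ℕ} {q k : ℕ}

/-- All parts at distance at most `m` from one of the elements `a i` are listed by `e`. -/
def NearIn (A : PartitionedStructure U B V) (m : ℕ) {n t : ℕ} (e : Fin n → ℕ) (a : Fin t → V) :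
    Prop :=
  ∀ i l, A.Near m (a i) l → l ∈ Set.range e

theorem NearIn.mono {m m' n t : ℕ} {e : Fin n → ℕ} {a : Fin t → V} (h : A.NearIn m e a)
    (hm : m' ≤ m) : A.NearIn m' e a :=
  fun i l hl => h i l (hl.mono hm)

theorem NearIn.cons {m m' r n t : ℕ} {e : Fin n → ℕ} {a : Fin t → V} (h : A.NearIn m e a)
    (hm : r + m' ≤ m) {i : Fin t} {c : V} (hc : Within A.gaifman r (a i) c) :
    A.NearIn m' e (Fin.cons c a : Fin (t + 1) → V) := by
  intro j
  refine Fin.cases ?_ (fun j => ?_) j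
  · rintro l ⟨b, hb, hcb⟩
    exact h i l ⟨b, hb, (hc.trans hcb).mono hm⟩
  · intro l hl
    exact h j l (hl.mono (by omega))

/-- The position given by two tuples. -/
def tuplePairs {t : ℕ} (a b : Fin t → V) : Set (V × V) :=
  Set.range fun i => (a i, b i)

theorem tuplePairs_cons {t : ℕ} (a b : Fin t → V) (c d : V) :
    tuplePairs (Fin.cons c a : Fin (t + 1) → V) (Fin.cons d b : Fin (t + 1) → V) =
      insert (c, d) (tuplePairs a b) := by
  ext p
  simp only [tuplePairs, Set.mem_range, Fin.exists_fin_succ, Fin.cons_zero, Fin.cons_succ,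
    Set.mem_insert_iff, eq_comm]

theorem swap_tuplePairs {t : ℕ} (a b : Fin t → V) :
    Prod.swap ⁻¹' (tuplePairs a b) = tuplePairs b a := by
  ext ⟨x, y⟩
  simp [tuplePairs, and_comm]

/-- The atomic type of a tuple: its unary predicates, its truncated distances to the parts
listed by `e`, its binary relations, and its truncated mutual distances. -/
def atomicType (A : PartitionedStructure U B V) (Λ M : ℕ) {n t : ℕ} (e : Fin n → ℕ)
    (a : Fin t → V) :
    (Fin t → U → Prop) × (Fin t → Fin n → Fin (Λ + 1) → Prop) × (Fin t → Fin t → B → Prop) ×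
      (Fin t → Fin t → Fin (M + 1) → Prop) :=
  (fun i Y => a i ∈ A.unary Y, fun i l m => A.Near m (a i) (e l),
    fun i j R => A.binary R (a i) (a j), fun i j m => Within A.gaifman m (a i) (a j))

theorem preserves_of_atomicType_eq {M n t : ℕ} {e : Fin n → ℕ} {a b : Fin t → V}
    (ha : A.NearIn Λ e a) (h : A.atomicType Λ M e a = A.atomicType Λ M e b) :
    A.Preserves Λ M (tuplePairs a b) := by
  simp only [atomicType, Prod.mk.injEq, funext_iff, eq_iff_iff] at h
  obtain ⟨hu, hn, hb, hw⟩ := h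
  refine ⟨?_, ?_, ?_, ?_⟩
  · rintro _ ⟨i, rfl⟩ Y
    exact (hu i Y).1
  · rintro _ ⟨i, rfl⟩ l m hm hl
    obtain ⟨l, rfl⟩ := ha i l (hl.mono hm)
    exact (hn i l ⟨m, by omega⟩).1 hl
  · rintro _ ⟨i, rfl⟩ _ ⟨j, rfl⟩ R
    exact (hb i j R).1
  · rintro _ ⟨i, rfl⟩ _ ⟨j, rfl⟩ m hm
    exact (hw i j ⟨m, by omega⟩).1

/-- The number of types of tuples in the local game is bounded, as long as only `n` parts are close
to the tuples. A tuple with `q + 1` remaining rounds is classified by its atomic type and by the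
types of its extensions by an element at distance at most `m` from the `i`-th element, for all `i`
and `m`. -/
theorem exists_localType (U B : Type v) [Finite U] [Finite B] (Λ n : ℕ) (q k t : ℕ) :
    ∃ N : ℕ, ∀ (V : Type u) (A : PartitionedStructure U B V) (e : Fin n → ℕ),
      ∃ τ : (Fin t → V) → Fin N, ∀ a b, A.NearIn (Λ + (sep k q - 1)) e a →
        A.NearIn (Λ + (sep k q - 1)) e b → τ a = τ b →
        A.GameEquiv Λ False q k (tuplePairs a b) := by
  -- It suffices to classify the tuples by the elements of a finite type.
  suffices h : ∃ (T : Type v) (_ : Finite T), ∀ (V : Type u) (A : PartitionedStructure U B V)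
      (e : Fin n → ℕ), ∃ τ : (Fin t → V) → T, ∀ a b, A.NearIn (Λ + (sep k q - 1)) e a →
        A.NearIn (Λ + (sep k q - 1)) e b → τ a = τ b →
        A.GameEquiv Λ False q k (tuplePairs a b) by
    obtain ⟨T, hT, h⟩ := h
    refine ⟨Nat.card T, fun V A e => ?_⟩
    obtain ⟨τ, hτ⟩ := h V A e
    exact ⟨fun a => Finite.equivFin T (τ a), fun a b ha hb hab =>
      hτ a b ha hb ((Finite.equivFin T).injective hab)⟩
  induction q generalizing k t with
  | zero =>
    refine ⟨_, inferInstance, fun V A e => ⟨A.atomicType Λ (sep k 0) e, fun a b ha hb hab => ?_⟩⟩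
    refine ⟨preserves_of_atomicType_eq (ha.mono (by omega)) hab, ?_⟩
    rw [swap_tuplePairs]
    exact preserves_of_atomicType_eq (hb.mono (by omega)) hab.symm
  | succ q ih =>
    obtain ⟨T, hT, h⟩ := ih (k + 1) (t + 1)
    refine ⟨((Fin t → U → Prop) × (Fin t → Fin n → Fin (Λ + 1) → Prop) ×
      (Fin t → Fin t → B → Prop) × (Fin t → Fin t → Fin (sep k (q + 1) + 1) → Prop)) ×
      (Fin t → Fin (localRadius k q + 1) → Set T), inferInstance, fun V A e => ?_⟩
    obtain ⟨τ, hτ⟩ := h V A e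
    have hsep := sep_succ k q
    have hpos := sep_pos (k + 1) q
    let σ : (Fin t → V) → Fin t → Fin (localRadius k q + 1) → Set T := fun a i m =>
      {x | ∃ c, Within A.gaifman m (a i) c ∧ τ (Fin.cons c a) = x}
    have key : ∀ {a b}, A.NearIn (Λ + (sep k (q + 1) - 1)) e a →
        A.NearIn (Λ + (sep k (q + 1) - 1)) e b → σ a = σ b →
        A.Forth False (localRadius k q) (A.GameEquiv Λ False q (k + 1)) (tuplePairs a b) := by
      intro a b ha hb hab
      refine ⟨False.elim, ?_⟩
      rintro _ ⟨i, rfl⟩ m hm c hc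
      have hmem : τ (Fin.cons c a) ∈ σ a i ⟨m, by omega⟩ := ⟨c, hc, rfl⟩
      rw [hab] at hmem
      obtain ⟨d, hd, hdc⟩ := hmem
      refine ⟨d, hd, ?_⟩
      rw [← tuplePairs_cons]
      exact hτ _ _ (ha.cons (by omega) hc) (hb.cons (by omega) hd) hdc.symm
    refine ⟨fun a => (A.atomicType Λ (sep k (q + 1)) e a, σ a), fun a b ha hb hab => ?_⟩
    rw [Prod.mk.injEq] at hab
    refine ⟨⟨preserves_of_atomicType_eq (ha.mono (by omega)) hab.1, key ha hb hab.2⟩, ?_⟩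
    rw [swap_tuplePairs]
    exact ⟨preserves_of_atomicType_eq (hb.mono (by omega)) hab.1.symm, key hb ha hab.2.symm⟩

/-- The number of one-element types in the local game with `q` rounds among elements such that only
`n` parts are close to them. -/
theorem exists_localType_singleton (U B : Type v) [Finite U] [Finite B] (Λ n q k : ℕ) :
    ∃ N : ℕ, ∀ (V : Type u) (A : PartitionedStructure U B V) (e : Fin n → ℕ),
      ∃ τ : V → Fin N, ∀ x y,
        (∀ l, A.Near (Λ + (sep k q - 1)) x l → l ∈ Set.range e) →
        (∀ l, A.Near (Λ + (sep k q - 1)) y l → l ∈ Set.range e) → τ x = τ y →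
        A.GameEquiv Λ False q k {(x, y)} := by
  obtain ⟨N, hN⟩ := exists_localType.{u, v} U B Λ n q k 1
  refine ⟨N, fun V A e => ?_⟩
  obtain ⟨τ, hτ⟩ := hN V A e
  refine ⟨fun x => τ fun _ => x, fun x y hx hy hxy => ?_⟩
  refine (hτ _ _ (fun _ => hx) (fun _ => hy) hxy).mono id ?_
  rintro p rfl
  exact ⟨0, rfl⟩

end PartitionedStructure

/-! ### First-order formulas -/

open FirstOrder in
/-- Duplicator's winning positions preserve formulas of bounded quantifier rank. -/
theorem realize_iff_of_gameEquiv {U B : Type v} {V : Type u} {A : PartitionedStructure U B V}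
    {Λ q k n : ℕ} {α : Type} (φ : (binaryLanguage U B).BoundedFormula α n)
    (hφ : quantifierRank φ ≤ q) {x y : α → V} {xs ys : Fin n → V} {Z : Set (V × V)}
    (h : A.GameEquiv Λ True q k Z) (hx : ∀ i, (x i, y i) ∈ Z) (hxs : ∀ i, (xs i, ys i) ∈ Z) :
    @Language.BoundedFormula.Realize _ V A.toStructure α n φ x xs ↔
      @Language.BoundedFormula.Realize _ V A.toStructure α n φ y ys := by
  let _ := A.toStructure
  have hterm : ∀ {n} {xs ys : Fin n → V} {Z : Set (V × V)}, (∀ i, (x i, y i) ∈ Z) →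
      (∀ i, (xs i, ys i) ∈ Z) → ∀ t : (binaryLanguage U B).Term (α ⊕ Fin n),
      (t.realize (Sum.elim x xs), t.realize (Sum.elim y ys)) ∈ Z := by
    intro n xs ys Z hx hxs t
    cases t with
    | var i => cases i with
      | inl i => exact hx i
      | inr i => exact hxs i
    | func f _ => exact nomatch f
  induction φ generalizing q k Z with
  | falsum => exact Iff.rfl
  | equal t₁ t₂ =>
    have h1 := hterm hx hxs t₁
    have h2 := hterm hx hxs t₂
    simp only [Language.BoundedFormula.Realize]
    constructor
    · intro he
      exact within_zero.1 (h.preserves.within _ h1 _ h2 0 (Nat.zero_le _) (within_zero.2 he))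
    · intro he
      exact within_zero.1 (h.preserves_swap.within (_, _) h1 (_, _) h2 0 (Nat.zero_le _)
        (within_zero.2 he))
  | rel R ts =>
    have ht := fun i => hterm hx hxs (ts i)
    cases R with
    | unary Y =>
      exact ⟨h.preserves.unary _ (ht 0) Y, h.preserves_swap.unary (_, _) (ht 0) Y⟩
    | binary R =>
      exact ⟨h.preserves.binary _ (ht 0) _ (ht 1) R,
        h.preserves_swap.binary (_, _) (ht 0) (_, _) (ht 1) R⟩
  | imp f g ihf ihg =>
    simp only [quantifierRank, max_le_iff] at hφ
    simp only [Language.BoundedFormula.realize_imp]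
    exact imp_congr (ihf hφ.1 h hx hxs) (ihg hφ.2 h hx hxs)
  | all f ih =>
    cases q with
    | zero => simp [quantifierRank] at hφ
    | succ q =>
      have hf : quantifierRank f ≤ q := Nat.le_of_succ_le_succ hφ
      have hsnoc : ∀ c d, ∀ i, ((Fin.snoc xs c : Fin _ → V) i, (Fin.snoc ys d : Fin _ → V) i) ∈
          insert (c, d) Z := by
        intro c d i
        refine Fin.lastCases ?_ (fun i => ?_) i
        · simp
        · simp only [Fin.snoc_castSucc]
          exact Or.inr (hxs i)
      simp only [Language.BoundedFormula.realize_all]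
      constructor
      · intro hall d
        obtain ⟨c, hc⟩ := h.2.2.1 trivial d
        have hc' : A.GameEquiv Λ True q (k + 1) (insert (c, d) Z) := by
          refine hc.symm.mono id ?_
          rintro p (rfl | hp)
          · exact Or.inl rfl
          · exact Or.inr (by simpa using hp)
        exact (ih hf hc' (fun i => Or.inr (hx i)) (hsnoc c d)).1 (hall c)
      · intro hall c
        obtain ⟨d, hd⟩ := h.1.2.1 trivial c
        exact (ih hf hd (fun i => Or.inr (hx i)) (hsnoc c d)).2 (hall d)

/-! ### Merge sequences from construction sequences -/

section MergeSequences

variable {V : Type u}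

theorem pairWidth_le {P : Setoid V} {R : SimpleGraph V} {r : ℕ} {N : ℕ∞}
    (h : ∀ x, (reachableParts P R r x).encard ≤ N) : pairWidth P R r ≤ N :=
  iSup_le h

theorem pairWidth_bot_le (P : Setoid V) (r : ℕ) : pairWidth P ⊥ r ≤ 1 := by
  refine pairWidth_le fun x => Set.encard_le_one_iff.2 ?_
  rintro S T ⟨hS, a, ha, hxa⟩ ⟨hT, b, hb, hxb⟩
  obtain rfl := within_bot.1 hxa
  obtain rfl := within_bot.1 hxb
  exact Setoid.eq_of_mem_classes hS ha hT hb

theorem pairWidth_top_le (R : SimpleGraph V) (r : ℕ) : pairWidth ⊤ R r ≤ 1 := by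
  refine pairWidth_le fun x => Set.encard_le_one_iff.2 ?_
  rintro S T ⟨⟨s, rfl⟩, -⟩ ⟨⟨t, rfl⟩, -⟩
  rfl

theorem pairWidth_zero_le (P : Setoid V) (R : SimpleGraph V) : pairWidth P R 0 ≤ 1 := by
  refine pairWidth_le fun x => Set.encard_le_one_iff.2 ?_
  rintro S T ⟨hS, a, ha, hxa⟩ ⟨hT, b, hb, hxb⟩
  obtain rfl := within_zero.1 hxa
  obtain rfl := within_zero.1 hxb
  exact Setoid.eq_of_mem_classes hS ha hT hb

theorem mergeWidth_le_of_nat {G : SimpleGraph V} {r : ℕ} {N : ℕ∞} (m : ℕ) (P : ℕ → Setoid V)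
    (R : ℕ → SimpleGraph V) (P_zero : P 0 = ⊥) (P_last : P m = ⊤) (P_mono : Monotone P)
    (R_mono : Monotone R)
    (homogeneous : ∀ t a b a' b', P t a a' → P t b b' → a ≠ b → ¬ (R t).Adj a b → a' ≠ b' →
      ¬ (R t).Adj a' b' → G.Adj a b → G.Adj a' b')
    (width : ∀ t < m, pairWidth (P t) (R (t + 1)) r ≤ N) : mergeWidth G r ≤ N := by
  let S : MergeSequence G :=
    { m := m
      P := fun t => P t
      R := fun t => R t
      P_first := P_zero
      P_last := P_last
      P_mono := fun s t h => P_mono h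
      R_mono := fun s t h => R_mono h
      homogeneous := by
        rintro t _ ⟨y, rfl⟩ _ ⟨z, rfl⟩
        by_cases h : ∃ a b, P t a y ∧ P t b z ∧ a ≠ b ∧ ¬ (R t).Adj a b ∧ G.Adj a b
        · obtain ⟨a, b, ha, hb, hab, hR, hG⟩ := h
          refine Or.inl fun a' ha' b' hb' hab' hR' => ?_
          exact homogeneous t a b a' b' ((P t).trans' ha ((P t).symm' ha'))
            ((P t).trans' hb ((P t).symm' hb')) hab hR hab' hR' hG
        · exact Or.inr fun a ha b hb hab hR hG => h ⟨a, b, ha, hb, hab, hR, hG⟩ }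
  refine (iInf_le _ S).trans (iSup_le fun t => ?_)
  exact width t t.2

theorem mergeWidth_zero_le (G : SimpleGraph V) : mergeWidth G 0 ≤ 1 := by
  refine mergeWidth_le_of_nat 1 (fun t => if t = 0 then ⊥ else ⊤)
    (fun t => if t = 0 then ⊥ else ⊤) (if_pos rfl) (if_neg one_ne_zero)
    (monotone_nat_of_le_succ fun t => by simp) (monotone_nat_of_le_succ fun t => by simp) ?_
    fun t _ => pairWidth_zero_le _ _
  intro t a b a' b' ha hb hab hR hab' hR'
  rcases Nat.eq_zero_or_pos t with rfl | ht
  · obtain rfl : a = a' := by simpa using ha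
    obtain rfl : b = b' := by simpa using hb
    exact id
  · rw [if_neg ht.ne'] at hR
    exact absurd hab (by simpa using hR)

end MergeSequences

namespace PartitionedStructure

variable {U B : Type v} {V : Type u}

/-- Elements are equivalent if Duplicator wins the unrestricted game with `q` rounds from the
position that consists of them. The parameter `2` leaves room for a second pair of elements. -/
def gameSetoid (A : PartitionedStructure U B V) (Λ q : ℕ) : Setoid V where
  r x y := A.GameEquiv Λ True q 2 {(x, y)}
  iseqv :=
    { refl := fun x => GameEquiv.of_diagonal (by rintro p rfl; rfl)
      symm := GameEquiv.symm_singleton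
      trans := GameEquiv.trans_singleton }

/-- The graph of all pairs of elements at distance at most `s` in the Gaifman graph. -/
def nearGraph (A : PartitionedStructure U B V) (s : ℕ) : SimpleGraph V where
  Adj a b := a ≠ b ∧ Within A.gaifman s a b
  symm := ⟨fun _ _ h => ⟨h.1.symm, h.2.symm⟩⟩
  loopless := ⟨fun _ h => h.1 rfl⟩

theorem within_nearGraph {A : PartitionedStructure U B V} {s r : ℕ} {a b : V}
    (h : Within (A.nearGraph s) r a b) : Within A.gaifman (r * s) a b :=
  Within.of_edges (G := A.nearGraph s) (fun _ _ h => h.2) h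

/-- For a single pair of elements, both versions of the game are equivalent. -/
theorem gameEquiv_of_local {A : PartitionedStructure U B V} {Λ q : ℕ} {x y : V}
    (h : A.GameEquiv Λ False q 2 {(x, y)}) : A.GameEquiv Λ True q 2 {(x, y)} := by
  have := GameEquiv.sUnion (A := A) (Λ := Λ) (q := q) (k := 2) (𝒞 := {{(x, y)}})
    (by rintro C rfl; exact h) (by rintro C rfl D rfl hne; exact absurd rfl hne) (by simp) (by simp)
  simpa using this

/-- Pairs of equivalent elements at a large distance are equivalent. -/
theorem gameEquiv_pair {A : PartitionedStructure U B V} {Λ q : ℕ} {x y x' y' : V}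
    (h : A.GameEquiv Λ True q 2 {(x, x')}) (h' : A.GameEquiv Λ True q 2 {(y, y')})
    (hxy : ¬ Within A.gaifman (sep 2 q) x y) (hxy' : ¬ Within A.gaifman (sep 2 q) x' y') :
    A.GameEquiv Λ True q 2 {(x, x'), (y, y')} := by
  have hunion : ⋃₀ ({{(x, x')}, {(y, y')}} : Set (Set (V × V))) =
      ({(x, x'), (y, y')} : Set (V × V)) := by
    rw [Set.sUnion_pair, Set.singleton_union]
  rw [← hunion]
  refine GameEquiv.sUnion ?_ ?_ ?_ ?_
  · rintro C (rfl | rfl)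
    · exact h.mono False.elim le_rfl
    · exact h'.mono False.elim le_rfl
  · rintro C (rfl | rfl) D (rfl | rfl) hne p rfl p' rfl
    · exact absurd rfl hne
    · exact ⟨hxy, hxy'⟩
    · exact ⟨fun h => hxy h.symm, fun h => hxy' h.symm⟩
    · exact absurd rfl hne
  · rw [hunion]; simp
  · rw [hunion]
    exact (Set.ncard_insert_le _ _).trans (by simp)

/-- If only parts listed by `e` are close to the elements reachable from `x`, then the number of
reachable classes is at most the number of local types. -/
theorem encard_reachableParts_le {A : PartitionedStructure U B V} {Λ q n N r : ℕ} {e : Fin n → ℕ}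
    {τ : V → Fin N} (hτ : ∀ x y,
        (∀ l, A.Near (Λ + (sep 2 q - 1)) x l → l ∈ Set.range e) →
        (∀ l, A.Near (Λ + (sep 2 q - 1)) y l → l ∈ Set.range e) → τ x = τ y →
        A.GameEquiv Λ False q 2 {(x, y)})
    {R : SimpleGraph V} {x : V}
    (hnear : ∀ a, Within R r x a → ∀ l, A.Near (Λ + (sep 2 q - 1)) a l → l ∈ Set.range e) :
    (reachableParts (A.gameSetoid Λ q) R r x).encard ≤ N := by
  have hrep : ∀ S : reachableParts (A.gameSetoid Λ q) R r x, ∃ a ∈ S.1, Within R r x a :=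
    fun S => S.2.2
  choose rep hmem hrep using hrep
  have hinj : Function.Injective fun S => τ (rep S) := by
    intro S T hST
    have h := gameEquiv_of_local (hτ _ _ (hnear _ (hrep S)) (hnear _ (hrep T)) hST)
    apply Subtype.ext
    obtain ⟨s, hs⟩ := S.2.1
    have hT : rep S ∈ T.1 := by
      obtain ⟨t, ht⟩ := T.2.1
      have hTt := hmem T
      rw [ht] at hTt ⊢
      exact (A.gameSetoid Λ q).trans' h hTt
    exact Setoid.eq_of_mem_classes S.2.1 (hmem S) T.2.1 hT
  have hle : ENat.card (reachableParts (A.gameSetoid Λ q) R r x) ≤ ENat.card (Fin N) :=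
    ENat.card_le_card_of_injective hinj
  simpa using hle

end PartitionedStructure

theorem sep_le_rho (k q : ℕ) : sep k q ≤ rho k q := by
  induction q generalizing k with
  | zero => exact le_rfl
  | succ q ih =>
    rw [sep, rho]
    exact Nat.mul_le_mul (Nat.succ_le_succ (Nat.pow_le_pow_left (by norm_num) k)) (ih _)

/-- A path of length `r` in the graph of pairs at distance at most `sep 2 q`, followed by a path of
length `2 * (sep 2 q - 1)`, stays within distance `r * (rho 2 q + 1)`. This is the inequality for
`r = 1`. -/
theorem three_mul_sep_le (q : ℕ) : 3 * sep 2 q ≤ rho 2 q + 3 := by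
  cases q with
  | zero => simp [sep, rho]
  | succ q =>
    have := sep_le_rho 3 q
    have h1 : sep 2 (q + 1) = 26 * sep 3 q := rfl
    have h2 : rho 2 (q + 1) = 170 * rho 3 q := rfl
    omega

theorem exists_range_of_encard_le {S : Set ℕ} {n : ℕ} (h : S.encard ≤ n) :
    ∃ e : Fin (n + 1) → ℕ, S ⊆ Set.range e := by
  have hfin : S.Finite := Set.finite_of_encard_le_coe h
  obtain ⟨s, rfl⟩ := hfin.exists_finset_coe
  have hs : s.card ≤ n := by
    rw [Set.encard_coe_eq_coe_finsetCard] at h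
    exact_mod_cast h
  refine ⟨fun i => if hi : i.1 < s.card then s.equivFin.symm ⟨i, hi⟩ else 0, fun l hl => ?_⟩
  have hlt := (s.equivFin ⟨l, hl⟩).2
  refine ⟨⟨s.equivFin ⟨l, hl⟩, by omega⟩, ?_⟩
  simp

open PartitionedStructure in
/-- The merge sequence of an interpreted graph: at time `t`, the partition consists of the classes
of the `q`-round game on the structure at time `t`, and the pairs at distance at most `sep 2 q` are
resolved. -/
theorem mergeWidth_interpret_le {U B : Type v} {V : Type u}
    {A : BinaryStructure U B V} (S : ConstructionSequence A) {q n N r : ℕ} (hr : 1 ≤ r)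
    (hS : S.width (r * (rho 2 q + 1)) ≤ n)
    (hN : ∀ (A : PartitionedStructure U B V) (e : Fin (n + 1) → ℕ),
      ∃ τ : V → Fin N, ∀ x y,
        (∀ l, A.Near (sep 2 q - 1 + (sep 2 q - 1)) x l → l ∈ Set.range e) →
        (∀ l, A.Near (sep 2 q - 1 + (sep 2 q - 1)) y l → l ∈ Set.range e) → τ x = τ y →
        A.GameEquiv (sep 2 q - 1) False q 2 {(x, y)})
    (φ : (binaryLanguage U B).Formula (Fin 2)) (hφ : quantifierRank φ ≤ q) :
    mergeWidth (interpret A.toStructure φ) r ≤ (max 1 N : ℕ) := by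
  obtain ⟨m, str, initial, step, one_part, reduct⟩ := S
  have h1N : (1 : ℕ∞) ≤ (max 1 N : ℕ) := by exact_mod_cast le_max_left 1 N
  have hNN : (N : ℕ∞) ≤ (max 1 N : ℕ) := by exact_mod_cast le_max_right 1 N
  set Λ := sep 2 q - 1 with hΛ
  have hpos := sep_pos 2 q
  -- The structures at times `0, …, m`, indexed by natural numbers.
  let st : ℕ → PartitionedStructure U B V := fun t => str ⟨min t m, by omega⟩
  have hst : ∀ t < m, (st t).Step (st (t + 1)) := by
    intro t ht
    have := step ⟨t, ht⟩
    convert this using 1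
    · exact congrArg str (Fin.ext (by simp; omega))
    · exact congrArg str (Fin.ext (by simp; omega))
  have hlast : st m = str (Fin.last m) := congrArg str (Fin.ext (by simp))
  have hzero : st 0 = str 0 := congrArg str (Fin.ext (by simp))
  have hwidth : ∀ t x, ((st t).reach (r * (rho 2 q + 1)) x).encard ≤ n := fun t x =>
    ((le_iSup (fun a => ((st t).reach (r * (rho 2 q + 1)) a).encard) x).trans
      (le_iSup (fun t => (str t).width (r * (rho 2 q + 1))) _)).trans hS
  have hmono : ∀ t ≤ m, ∀ Z, (st t).GameEquiv Λ True q 2 Z → (st m).GameEquiv Λ True q 2 Z := by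
    intro t ht Z
    induction ht using Nat.decreasingInduction with
    | self => exact id
    | of_succ t ht ih => exact fun h => ih (h.step (by omega) (hst t ht))
  have hgaif : ∀ t < m, (st t).gaifman ≤ (st (t + 1)).gaifman := by
    intro t ht
    rcases hst t ht with ⟨i, j, -, h⟩ | ⟨R, i, j, h⟩
    · rw [h]; exact le_rfl
    · rw [h]; exact gaifman_le_resolve _ _ _ _
  -- The partition into singletons is added in front, and the trivial partition at the end. The
  -- widths at both ends are bounded since the first Gaifman graph is edgeless and since there is
  -- only one part at time `m`.
  let P : ℕ → Setoid V
    | 0 => ⊥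
    | t + 1 => if t ≤ m then (st t).gameSetoid Λ q else ⊤
  let R : ℕ → SimpleGraph V
    | 0 => ⊥
    | t + 1 => if t ≤ m then (st t).nearGraph (sep 2 q) else ⊤
  have hP : ∀ t ≤ m, P (t + 1) = (st t).gameSetoid Λ q := fun t ht => if_pos ht
  have hR : ∀ t ≤ m, R (t + 1) = (st t).nearGraph (sep 2 q) := fun t ht => if_pos ht
  have hP' : ∀ t, m < t → P (t + 1) = ⊤ := fun t ht => if_neg (by omega)
  have hR' : ∀ t, m < t → R (t + 1) = ⊤ := fun t ht => if_neg (by omega)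
  refine mergeWidth_le_of_nat (m + 2) P R rfl (hP' _ (by omega)) (monotone_nat_of_le_succ ?_)
    (monotone_nat_of_le_succ ?_) ?_ ?_
  · rintro (_ | t)
    · exact bot_le
    rcases lt_or_ge t m with ht | ht
    · rw [hP _ ht.le, hP _ ht]
      exact fun x y h => GameEquiv.step (by omega) h (hst t ht)
    · rw [hP' (t + 1) (by omega)]
      exact le_top
  · rintro (_ | t)
    · exact bot_le
    rcases lt_or_ge t m with ht | ht
    · rw [hR _ ht.le, hR _ ht]
      exact fun a b h => ⟨h.1, h.2.mono_graph (hgaif t ht)⟩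
    · rw [hR' (t + 1) (by omega)]
      exact le_top
  · rintro (_ | t) a b a' b' ha hb hab hab' hne hne' hG
    · obtain rfl : a = a' := ha
      obtain rfl : b = b' := hb
      exact hG
    rcases le_or_gt t m with ht | ht
    · rw [hP t ht] at ha hb
      rw [hR t ht] at hab' hne'
      have hfar : ¬ Within (st t).gaifman (sep 2 q) a b := fun h => hab' ⟨hab, h⟩
      have hfar' : ¬ Within (st t).gaifman (sep 2 q) a' b' := fun h => hne' ⟨hne, h⟩
      have hgame := hmono t ht _ (gameEquiv_pair ha hb hfar hfar')
      have hA : (st m).toBinaryStructure = A := by rw [hlast, reduct]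
      subst hA
      simp only [interpret, SimpleGraph.fromRel_adj] at hG ⊢
      refine ⟨hne, hG.2.imp ?_ ?_⟩
      · refine (realize_iff_of_gameEquiv φ hφ hgame (fun i => ?_) (fun i => i.elim0)).1
        fin_cases i <;> simp
      · refine (realize_iff_of_gameEquiv φ hφ hgame (fun i => ?_) (fun i => i.elim0)).1
        fin_cases i <;> simp
    · rw [hR' t ht] at hab'
      exact absurd hab (by simpa using hab')
  · rintro (_ | t) ht
    · refine le_trans ?_ h1N
      have hbot : R 1 = ⊥ := by
        rw [hR 0 (Nat.zero_le _)]
        ext a b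
        simp only [nearGraph, hzero, initial.1, within_bot, SimpleGraph.bot_adj, iff_false]
        exact fun h => h.1 h.2
      rw [hbot]
      exact pairWidth_bot_le _ _
    refine le_trans ?_ hNN
    rcases lt_or_ge t m with ht | ht'
    · rw [hP t ht.le, hR _ ht]
      refine pairWidth_le fun x => ?_
      -- The parts at time `t` close to elements reachable at time `t + 1` are counted by the
      -- width at time `t` if the step is a merge, and at time `t + 1` if it is a resolve operation.
      obtain ⟨s, hpart, hgs⟩ : ∃ s, (st s).part = (st t).part ∧
          (st s).gaifman = (st (t + 1)).gaifman := by
        rcases hst t ht with ⟨i, j, -, h⟩ | ⟨R, i, j, h⟩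
        · exact ⟨t, rfl, by rw [h]; rfl⟩
        · exact ⟨t + 1, by rw [h]; rfl, rfl⟩
      have hinr : (Sum.inr ⁻¹' ((st s).reach (r * (rho 2 q + 1)) x) : Set ℕ).encard ≤ n := by
        rw [← Sum.inr_injective.encard_image]
        exact (Set.encard_le_encard (Set.image_preimage_subset _ _)).trans (hwidth s x)
      obtain ⟨e, he⟩ := exists_range_of_encard_le hinr
      obtain ⟨τ, hτ⟩ := hN (st t) e
      refine encard_reachableParts_le hτ fun a hxa l hl => he ?_
      obtain ⟨b, hb, hab⟩ := hl
      refine ⟨b, ?_, ?_⟩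
      · change b ∈ (st s).part l
        rwa [hpart]
      · rw [hgs]
        have h1 := (within_nearGraph hxa).trans (hab.mono_graph (hgaif t ht))
        refine h1.mono ?_
        have h3 := three_mul_sep_le q
        have h4 : r * (2 * sep 2 q - 2) + r * sep 2 q ≤ r * (rho 2 q + 1) := by
          rw [← Nat.mul_add]
          exact Nat.mul_le_mul_left _ (by omega)
        have h5 : 2 * sep 2 q - 2 ≤ r * (2 * sep 2 q - 2) := Nat.le_mul_of_pos_left _ hr
        omega
    · obtain rfl : t = m := by omega
      rw [hP t le_rfl]
      refine pairWidth_le fun x => ?_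
      obtain ⟨i, hi⟩ := one_part
      obtain ⟨τ, hτ⟩ := hN (st t) fun _ => i
      refine encard_reachableParts_le hτ ?_
      rintro a - l ⟨b, hb, -⟩
      refine ⟨0, ?_⟩
      by_contra hne
      rw [hlast, hi l (fun h => hne h.symm)] at hb
      exact hb

theorem exists_constructionSequence_width_le {U B : Type v} {V : Type u}
    {A : BinaryStructure U B V} {r n : ℕ} (h : A.mergeWidth r ≤ n) :
    ∃ S : ConstructionSequence A, S.width r ≤ n := by
  have hlt : A.mergeWidth r < (n : ℕ∞) + 1 :=
    lt_of_le_of_lt h (by exact_mod_cast Nat.lt_succ_self n)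
  obtain ⟨S, hS⟩ := iInf_lt_iff.1 hlt
  exact ⟨S, Order.le_of_lt_add_one hS⟩

theorem exists_bound_mergeWidth_interpret (U B : Type v) [Finite U] [Finite B] :
    ∃ f : ℕ → ℕ → ℕ, ∀ (q r n : ℕ) (V : Type u) (A : BinaryStructure U B V)
      (φ : (binaryLanguage U B).Formula (Fin 2)), quantifierRank φ ≤ q →
      A.mergeWidth (r * (rho 2 q + 1)) ≤ n →
      mergeWidth (interpret A.toStructure φ) r ≤ f q n := by
  choose N hN using fun q n => PartitionedStructure.exists_localType_singleton.{u, v} U B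
    (sep 2 q - 1) (n + 1) q 2
  refine ⟨fun q n => max 1 (N q n), fun q r n V A φ hφ hA => ?_⟩
  rcases Nat.eq_zero_or_pos r with rfl | hr
  · exact (mergeWidth_zero_le _).trans (by exact_mod_cast le_max_left 1 (N q n))
  · obtain ⟨S, hS⟩ := exists_constructionSequence_width_le hA
    exact mergeWidth_interpret_le S hr hS (hN q n V) φ hφ

/-! ### Construction sequences from merge sequences -/

section Construction

variable {U : Type} {V : Type u}

/-- The expansion of a graph by unary predicates, with a binary symbol `true` for adjacency and a
binary symbol `false` for non-adjacency of possibly equal elements, so that exactly one of them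
holds for each pair. -/
def fullExpansion (G : SimpleGraph V) (Y : U → Set V) : BinaryStructure U Bool V where
  unary := Y
  binary S a b := G.Adj a b ↔ S = true

/-- The partitioned structure with the part predicates `{v | p v = l}`, in which exactly the pairs
in `D` have received their relation. -/
def labelState (G : SimpleGraph V) (Y : U → Set V) (p : V → ℕ) (D : V → V → Prop) :
    PartitionedStructure U Bool V where
  unary := Y
  binary S a b := D a b ∧ (G.Adj a b ↔ S = true)
  part l := {v | p v = l}
  part_disjoint i j hij := by
    rw [Set.disjoint_left]
    rintro v rfl hj
    exact hij hj

variable {G : SimpleGraph V} {Y : U → Set V} {p : V → ℕ} {D : V → V → Prop}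

theorem exists_labelState_binary {a b : V} :
    (∃ S, (labelState G Y p D).binary S a b) ↔ D a b := by
  refine ⟨fun ⟨S, h⟩ => h.1, fun h => ?_⟩
  by_cases hG : G.Adj a b
  · exact ⟨true, h, by simp [hG]⟩
  · exact ⟨false, h, by simp [hG]⟩

theorem labelState_gaifman_adj {a b : V} :
    (labelState G Y p D).gaifman.Adj a b ↔ a ≠ b ∧ (D a b ∨ D b a) := by
  rw [PartitionedStructure.gaifman_adj, exists_or, exists_labelState_binary,
    exists_labelState_binary]

theorem labelState_gaifman_le {R : SimpleGraph V} (hD : ∀ a b, D a b → a ≠ b → R.Adj a b) :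
    (labelState G Y p D).gaifman ≤ R := by
  intro a b h
  rw [labelState_gaifman_adj] at h
  obtain ⟨hab, h | h⟩ := h
  · exact hD a b h hab
  · exact (hD b a h hab.symm).symm

theorem labelState_merge (i j : ℕ) (hij : i ≠ j) :
    (labelState G Y p D).merge i j = labelState G Y (fun v => if p v = j then i else p v) D := by
  simp only [labelState, PartitionedStructure.merge, PartitionedStructure.mk.injEq, true_and]
  funext l
  ext v
  split_ifs with h1 h2
  · subst h1
    simp only [Set.mem_union, Set.mem_ofPred_eq]
    split_ifs with h <;> simp [h]
  · subst h2
    simp only [Set.mem_empty_iff_false, Set.mem_ofPred_eq, false_iff]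
    split_ifs with h
    · exact hij
    · exact h
  · simp only [Set.mem_ofPred_eq]
    split_ifs with h
    · exact ⟨fun h' => absurd (h'.symm.trans h) h2, fun h' => absurd h'.symm h1⟩
    · exact Iff.rfl

theorem labelState_resolve (S : Bool) (i j : ℕ)
    (h : ∀ a b, p a = i → p b = j → ¬ D a b → (G.Adj a b ↔ S = true)) :
    (labelState G Y p D).resolve S i j =
      labelState G Y p fun a b => D a b ∨ (p a = i ∧ p b = j) := by
  simp only [labelState, PartitionedStructure.resolve, PartitionedStructure.mk.injEq,
    BinaryStructure.mk.injEq, true_and, and_true]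
  funext T a b
  have hD : (∀ T, ¬ (labelState G Y p D).binary T a b) ↔ ¬ D a b := by
    rw [← exists_labelState_binary (G := G) (Y := Y) (p := p)
      (D := D) (a := a) (b := b), not_exists]
  change (D a b ∧ (G.Adj a b ↔ T = true) ∨ T = S ∧ p a = i ∧ p b = j ∧
    ∀ T, ¬ (labelState G Y p D).binary T a b) = _
  rw [hD, eq_iff_iff]
  by_cases hab : D a b
  · simp [hab]
  · simp only [hab, false_and, not_false_eq_true, and_true, false_or]
    constructor
    · rintro ⟨rfl, hi, hj⟩
      exact ⟨⟨hi, hj⟩, h a b hi hj hab⟩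
    · rintro ⟨⟨hi, hj⟩, hT⟩
      rw [h a b hi hj hab] at hT
      exact ⟨(Bool.eq_iff_iff.2 hT).symm, hi, hj⟩

/-- A step of a construction sequence to a structure of radius-`r` width at most `N`. -/
def BoundedStep (r : ℕ) (N : ℕ∞) (A A' : PartitionedStructure U Bool V) : Prop :=
  A.Step A' ∧ A'.width r ≤ N

theorem exists_constructionSequence {A : BinaryStructure U Bool V} {r : ℕ} {N : ℕ∞}
    {A₀ A₁ : PartitionedStructure U Bool V} (h : Relation.ReflTransGen (BoundedStep r N) A₀ A₁)
    (h₀ : A₀.IsInitial) (hw : A₀.width r ≤ N) (h₁ : ∃ i, ∀ j, j ≠ i → A₁.part j = ∅)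
    (hA : A₁.toBinaryStructure = A) : A.mergeWidth r ≤ N := by
  obtain ⟨m, f, hf0, hfm, hstep⟩ : ∃ (m : ℕ) (f : ℕ → PartitionedStructure U Bool V),
      f 0 = A₀ ∧ f m = A₁ ∧ ∀ t < m, BoundedStep r N (f t) (f (t + 1)) := by
    clear h₁ hA
    induction h with
    | refl => exact ⟨0, fun _ => A₀, rfl, rfl, by simp⟩
    | @tail A₁ A₂ _ h12 ih =>
      obtain ⟨m, f, hf0, hfm, hstep⟩ := ih
      refine ⟨m + 1, fun t => if t ≤ m then f t else A₂, by simpa using hf0, by simp, ?_⟩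
      intro t ht
      rcases Nat.lt_or_ge t m with htm | htm
      · simpa [htm.le, Nat.succ_le_of_lt htm] using hstep t htm
      · obtain rfl : t = m := by omega
        simpa [hfm] using h12
  let S : ConstructionSequence A :=
    { m := m
      str := fun t => f t
      initial := by
        change (f 0).IsInitial
        rwa [hf0]
      step := fun t => (hstep t t.2).1
      one_part := by
        change ∃ i, ∀ j, j ≠ i → (f m).part j = ∅
        rwa [hfm]
      reduct := by
        change (f m).toBinaryStructure = A
        rw [hfm, hA] }
  refine (iInf_le _ S).trans (iSup_le fun t => ?_)
  obtain ⟨t, ht⟩ := t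
  cases t with
  | zero =>
    change (f 0).width r ≤ N
    rwa [hf0]
  | succ t => exact (hstep t (Nat.lt_of_succ_lt_succ ht)).2

/-- Resolving one rectangle after the other. -/
theorem reflTransGen_resolve [Finite V] {r : ℕ} {N : ℕ∞} {D' : V → V → Prop}
    (hDD' : ∀ a b, D a b → D' a b)
    (rect : ∀ a b a' b', p a = p a' → p b = p b' → D' a b → ¬ D a b → D' a' b')
    (hom : ∀ a b a' b', p a = p a' → p b = p b' → ¬ D a b → ¬ D a' b' →
      (G.Adj a b ↔ G.Adj a' b'))
    (hw : ∀ D'' : V → V → Prop, (∀ a b, D'' a b → D' a b) → (labelState G Y p D'').width r ≤ N) :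
    Relation.ReflTransGen (BoundedStep r N) (labelState G Y p D) (labelState G Y p D') := by
  classical
  generalize hn : {x : V × V | D' x.1 x.2 ∧ ¬ D x.1 x.2}.ncard = n
  induction n using Nat.strong_induction_on generalizing D with
  | _ n ih =>
    by_cases hD : ∀ a b, D' a b → D a b
    · obtain rfl : D = D' := by
        funext a b
        exact propext ⟨hDD' a b, hD a b⟩
      exact .refl
    push Not at hD
    obtain ⟨a, b, hab', hab⟩ := hD
    let E : V → V → Prop := fun x y => D x y ∨ (p x = p a ∧ p y = p b)
    have hE : ∀ x y, E x y → D' x y := by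
      rintro x y (h | ⟨hx, hy⟩)
      · exact hDD' x y h
      · exact rect a b x y hx.symm hy.symm hab' hab
    have hstep : BoundedStep r N (labelState G Y p D) (labelState G Y p E) := by
      refine ⟨Or.inr ⟨decide (G.Adj a b), p a, p b, ?_⟩, hw _ hE⟩
      rw [labelState_resolve]
      intro x y hx hy hxy
      rw [hom x y a b hx hy hxy hab, decide_eq_true_iff]
    refine .head hstep (ih _ ?_ hE ?_ ?_ rfl)
    · rw [← hn]
      refine Set.ncard_lt_ncard ⟨fun x hx => ⟨hx.1, fun h => hx.2 (Or.inl h)⟩, fun h => ?_⟩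
        (Set.toFinite _)
      exact (h (show (a, b) ∈ _ from ⟨hab', hab⟩)).2 (Or.inr ⟨rfl, rfl⟩)
    · exact fun x y x' y' hx hy h h' => rect x y x' y' hx hy h fun h => h' (Or.inl h)
    · exact fun x y x' y' hx hy h h' => hom x y x' y' hx hy
        (fun h₁ => h (Or.inl h₁)) fun h₁ => h' (Or.inl h₁)

/-- Merging parts one after the other until the partition `Q` is reached. -/
theorem reflTransGen_merge [Finite V] {r : ℕ} {N : ℕ∞} {Q : Setoid V}
    (hQ : ∀ a b, p a = p b → Q a b)
    (hw : ∀ p' : V → ℕ, (∀ a b, p a = p b → p' a = p' b) → (labelState G Y p' D).width r ≤ N) :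
    ∃ p' : V → ℕ, (∀ a b, p' a = p' b ↔ Q a b) ∧
      Relation.ReflTransGen (BoundedStep r N) (labelState G Y p D) (labelState G Y p' D) := by
  classical
  generalize hn : (Set.range p).ncard = n
  induction n using Nat.strong_induction_on generalizing p with
  | _ n ih =>
    by_cases hp : ∀ a b, Q a b → p a = p b
    · exact ⟨p, fun a b => ⟨hQ a b, hp a b⟩, .refl⟩
    push Not at hp
    obtain ⟨a, b, hab, hne⟩ := hp
    let p₁ : V → ℕ := fun v => if p v = p b then p a else p v
    have hp₁ : ∀ x y, p x = p y → p₁ x = p₁ y := fun x y h => by simp only [p₁, h]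
    have hstep : BoundedStep r N (labelState G Y p D) (labelState G Y p₁ D) :=
      ⟨Or.inl ⟨p a, p b, hne, (labelState_merge _ _ hne).symm⟩, hw p₁ hp₁⟩
    have hcard : (Set.range p₁).ncard < n := by
      rw [← hn]
      refine Set.ncard_lt_ncard ⟨?_, fun h => ?_⟩ (Set.toFinite _)
      · rintro _ ⟨v, rfl⟩
        simp only [p₁]
        split_ifs
        exacts [⟨a, rfl⟩, ⟨v, rfl⟩]
      · obtain ⟨v, hv⟩ := h ⟨b, rfl⟩
        simp only [p₁] at hv
        split_ifs at hv with h
        exacts [hne hv, h hv]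
    have hQ₁ : ∀ x y, p₁ x = p₁ y → Q x y := by
      intro x y hxy
      simp only [p₁] at hxy
      split_ifs at hxy with hx hy hy
      · exact hQ x y (hx.trans hy.symm)
      · exact Q.trans' (hQ x b hx) (Q.trans' (Q.symm' hab) (hQ a y hxy))
      · exact Q.trans' (hQ x a hxy) (Q.trans' hab (hQ b y hy.symm))
      · exact hQ x y hxy
    obtain ⟨p', hp', hreach⟩ := ih _ hcard hQ₁
      (fun p' h => hw p' fun x y hxy => h x y (hp₁ x y hxy)) rfl
    exact ⟨p', hp', .head hstep hreach⟩

theorem width_labelState_le [Finite U] {P : Setoid V} {R : SimpleGraph V} {r : ℕ}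
    (hp : ∀ a b, P a b → p a = p b) (hD : ∀ a b, D a b → a ≠ b → R.Adj a b) :
    (labelState G Y p D).width r ≤ ENat.card U + pairWidth P R r := by
  refine iSup_le fun x => ?_
  -- The part predicates reachable from `x` are images of reachable classes of `P`.
  let lab : Set V → ℕ := fun S => sInf (p '' S)
  have hsub : (labelState G Y p D).reach r x ⊆
      Set.range Sum.inl ∪ Sum.inr '' (lab '' (reachableParts P R r x)) := by
    rintro (Y | l) ⟨b, hb, hxb⟩
    · exact Or.inl ⟨Y, rfl⟩
    · refine Or.inr ⟨l, ⟨{c | P c b}, ⟨⟨b, rfl⟩, b, P.refl' b, ?_⟩, ?_⟩, rfl⟩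
      · exact Within.mono_graph hxb (labelState_gaifman_le hD)
      · have himg : p '' {c | P c b} = {l} := by
          ext i
          constructor
          · rintro ⟨c, hc, rfl⟩
            exact (hp c b hc).trans hb
          · rintro rfl
            exact ⟨b, P.refl' b, hb⟩
        simp only [lab, himg, csInf_singleton]
  refine (Set.encard_le_encard hsub).trans ((Set.encard_union_le _ _).trans ?_)
  refine add_le_add ?_ ?_
  · rw [← Set.image_univ, Sum.inl_injective.encard_image, Set.encard_univ]
  · rw [Sum.inr_injective.encard_image]
    exact (Set.encard_image_le _ _).trans (le_iSup (fun x => (reachableParts P R r x).encard) x)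

theorem mergeWidth_fullExpansion_le [Finite V] [Finite U] (G : SimpleGraph V) (Y : U → Set V)
    {r : ℕ} (S : MergeSequence G) :
    (fullExpansion G Y).mergeWidth r ≤ ENat.card U + max 1 (S.width r) := by
  set N := ENat.card U + max 1 (S.width r) with hN
  obtain ⟨m, P, R, P_first, P_last, P_mono, R_mono, homogeneous⟩ := S
  have hone : ∀ {P : Setoid V} {R : SimpleGraph V}, pairWidth P R r ≤ 1 →
      ENat.card U + pairWidth P R r ≤ N :=
    fun h => add_le_add le_rfl (h.trans (le_max_left _ _))
  have hwidth : ∀ t : Fin m, ENat.card U + pairWidth (P t.castSucc) (R t.succ) r ≤ N := fun t =>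
    add_le_add le_rfl ((le_iSup (fun t : Fin m => pairWidth (P t.castSucc) (R t.succ) r) t).trans
      (le_max_right _ _))
  have hhom : ∀ t a b a' b', P t a a' → P t b b' → a ≠ b → ¬ (R t).Adj a b → a' ≠ b' →
      ¬ (R t).Adj a' b' → (G.Adj a b ↔ G.Adj a' b') := by
    intro t a b a' b' ha hb hab hR hab' hR'
    rcases homogeneous t {c | P t c a} ⟨a, rfl⟩ {c | P t c b} ⟨b, rfl⟩ with h | h
    · exact iff_of_true (h a ((P t).refl' a) b ((P t).refl' b) hab hR)
        (h a' ((P t).symm' ha) b' ((P t).symm' hb) hab' hR')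
    · exact iff_of_false (h a ((P t).refl' a) b ((P t).refl' b) hab hR)
        (h a' ((P t).symm' ha) b' ((P t).symm' hb) hab' hR')
  -- The diagonal pairs have their relation from the start. This does not affect the Gaifman graph,
  -- and prevents resolve operations from adding loops.
  let p₀ : V → ℕ := fun v => Finite.equivFin V v
  have hp₀ : ∀ a b, p₀ a = p₀ b ↔ a = b := fun a b => by simp [p₀, Fin.val_inj]
  have hchain : ∀ t : Fin (m + 1), ∃ (p : V → ℕ) (D : V → V → Prop),
      (∀ a b, p a = p b ↔ P t a b) ∧ (∀ a, D a a) ∧ (∀ a b, D a b → a ≠ b → (R t).Adj a b) ∧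
      (∀ a b a' b', p a = p a' → p b = p b' → ¬ D a b → ¬ D a' b' →
        (G.Adj a b ↔ G.Adj a' b')) ∧
      Relation.ReflTransGen (BoundedStep r N) (labelState G Y p₀ Eq) (labelState G Y p D) := by
    intro t
    induction t using Fin.induction with
    | zero =>
      refine ⟨p₀, Eq, fun a b => ?_, fun a => rfl, fun a b h h' => absurd h h',
        fun a b a' b' ha hb _ _ => ?_, .refl⟩
      · rw [hp₀, P_first]; rfl
      · rw [(hp₀ a a').1 ha, (hp₀ b b').1 hb]
    | succ t ih =>
      obtain ⟨p, D, hp, hdiag, hD, hom, hreach⟩ := ih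
      -- The rectangles of parts all of whose unresolved pairs are in `R (t + 1)` are resolved. Each
      -- remaining rectangle contains an unresolved pair outside of `R (t + 1)`; hence the
      -- unresolved pairs in remaining rectangles within the same parts of `P (t + 1)` agree.
      let D' : V → V → Prop := fun a b => D a b ∨
        ∀ a' b', p a = p a' → p b = p b' → ¬ D a' b' → (R t.succ).Adj a' b'
      have hDD' : ∀ a b, D a b → D' a b := fun a b h => Or.inl h
      have hD' : ∀ a b, D' a b → a ≠ b → (R t.succ).Adj a b := by
        rintro a b h hab
        by_cases hDab : D a b
        · exact R_mono t.castSucc_le_succ (hD a b hDab hab)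
        · exact (h.resolve_left hDab) a b rfl rfl hDab
      have hle : ∀ a b, P t.castSucc a b → P t.succ a b := P_mono t.castSucc_le_succ
      have h1 : Relation.ReflTransGen (BoundedStep r N) (labelState G Y p D)
          (labelState G Y p D') := by
        refine reflTransGen_resolve hDD' ?_ hom fun D'' hD'' => ?_
        · rintro a b a' b' ha hb h hDab
          refine Or.inr fun x y hx hy => ?_
          exact (h.resolve_left hDab) x y (ha.trans hx) (hb.trans hy)
        · exact (width_labelState_le (fun a b h => (hp a b).2 h)
            fun a b h => hD' a b (hD'' a b h)).trans (hwidth t)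
      obtain ⟨p', hp', h2⟩ := reflTransGen_merge (G := G) (Y := Y) (p := p) (D := D') (r := r)
        (N := N) (Q := P t.succ) (fun a b h => hle a b ((hp a b).1 h)) fun p' hp' =>
          (width_labelState_le (fun a b h => hp' a b ((hp a b).2 h)) hD').trans (hwidth t)
      refine ⟨p', D', hp', fun a => Or.inl (hdiag a), hD', ?_, (hreach.trans h1).trans h2⟩
      have hrep : ∀ a b, ¬ D' a b → ∃ x y, P t.succ a x ∧ P t.succ b y ∧ x ≠ y ∧
          ¬ (R t.succ).Adj x y ∧ (G.Adj a b ↔ G.Adj x y) := by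
        intro a b hab
        simp only [D', not_or] at hab
        push Not at hab
        obtain ⟨hDab, x, y, hx, hy, hxy, hR⟩ := hab
        refine ⟨x, y, hle a x ((hp a x).1 hx), hle b y ((hp b y).1 hy), ?_, hR,
          hom a b x y hx hy hDab hxy⟩
        rintro rfl
        exact hxy (hdiag x)
      intro a b a' b' ha hb hab hab'
      obtain ⟨x, y, hx, hy, hxy, hR, hG⟩ := hrep a b hab
      obtain ⟨x', y', hx', hy', hxy', hR', hG'⟩ := hrep a' b' hab'
      rw [hG, hG']
      have haa := (hp' a a').1 ha
      have hbb := (hp' b b').1 hb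
      exact hhom t.succ x y x' y' ((P t.succ).trans' ((P t.succ).symm' hx)
        ((P t.succ).trans' haa hx')) ((P t.succ).trans' ((P t.succ).symm' hy)
        ((P t.succ).trans' hbb hy')) hxy hR hxy' hR'
  obtain ⟨p, D, hp, hdiag, hD, hom, hreach⟩ := hchain (Fin.last m)
  have hp1 : ∀ a b, p a = p b := fun a b => by rw [hp, P_last]; trivial
  have hfinal : Relation.ReflTransGen (BoundedStep r N) (labelState G Y p D)
      (labelState G Y p fun _ _ => True) := by
    refine reflTransGen_resolve (fun _ _ _ => trivial) (fun _ _ _ _ _ _ _ _ => trivial) hom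
      fun D'' _ => ?_
    exact (width_labelState_le (P := ⊤) (R := ⊤) (fun a b _ => hp1 a b) fun a b _ h => h).trans
      (hone (pairWidth_top_le _ _))
  refine exists_constructionSequence (hreach.trans hfinal) ⟨?_, ?_⟩ ?_ ?_ ?_
  · exact le_bot_iff.1 (labelState_gaifman_le fun a b h h' => absurd h h')
  · intro i a ha b hb
    exact (hp₀ a b).1 (Eq.trans ha (Eq.symm hb))
  · exact (width_labelState_le (P := ⊥) (R := ⊥) (fun a b h => congrArg p₀ h)
      fun a b h h' => absurd h h').trans (hone (pairWidth_bot_le _ _))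
  · by_cases hV : Nonempty V
    · obtain ⟨v⟩ := hV
      refine ⟨p v, fun j hj => Set.eq_empty_of_forall_notMem fun x hx => hj ?_⟩
      exact (Eq.symm hx).trans (hp1 x v)
    · exact ⟨0, fun j _ => Set.eq_empty_of_forall_notMem fun x _ => hV ⟨x⟩⟩
  · simp [labelState, fullExpansion]

theorem mergeWidth_fullExpansion_le_mergeWidth [Finite V] [Finite U] (G : SimpleGraph V)
    (Y : U → Set V) {r n : ℕ} (h : mergeWidth G r ≤ n) :
    (fullExpansion G Y).mergeWidth r ≤ (Nat.card U + max 1 n : ℕ) := by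
  have hlt : mergeWidth G r < (n : ℕ∞) + 1 :=
    lt_of_le_of_lt h (by exact_mod_cast Nat.lt_succ_self n)
  obtain ⟨S, hS⟩ := iInf_lt_iff.1 hlt
  have hS' : S.width r ≤ n := Order.le_of_lt_add_one hS
  refine (mergeWidth_fullExpansion_le G Y S).trans ?_
  rw [Nat.cast_add, ENat.card_eq_coe_natCard]
  refine add_le_add le_rfl (max_le ?_ (hS'.trans ?_))
  · exact_mod_cast le_max_left 1 n
  · exact_mod_cast le_max_right 1 n

end Construction

/-! ### Transductions -/

/-- Merge-width does not increase when passing to induced subgraphs. -/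
theorem mergeWidth_le_of_embedding {V : Type u} {W : Type v} {G : SimpleGraph V}
    {H : SimpleGraph W} (f : H ↪g G) (r : ℕ) : mergeWidth H r ≤ mergeWidth G r := by
  refine le_iInf fun S => ?_
  obtain ⟨m, P, R, P_first, P_last, P_mono, R_mono, homogeneous⟩ := S
  have hwithin : ∀ t a b, Within ((R t).comap f) r a b → Within (R t) r (f a) (f b) := by
    intro t a b h
    exact h.rec_adj (C := fun m b => Within (R t) m (f a) (f b)) (Within.refl _ _ _)
      (fun _ _ _ hmn h => h.mono hmn) fun _ _ _ h hbc => h.trans (Within.of_adj hbc)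
  let T : MergeSequence H :=
    { m := m
      P := fun t => (P t).comap f
      R := fun t => (R t).comap f
      P_first := by
        rw [P_first]
        ext a b
        exact f.injective.eq_iff
      P_last := by rw [P_last]; rfl
      P_mono := fun s t h a b hab => P_mono h hab
      R_mono := fun s t h a b hab => R_mono h hab
      homogeneous := by
        rintro t _ ⟨y, rfl⟩ _ ⟨z, rfl⟩
        refine (homogeneous t {c | P t c (f y)} ⟨f y, rfl⟩ {c | P t c (f z)} ⟨f z, rfl⟩).imp
          (fun h a ha b hb hab hR => ?_) (fun h a ha b hb hab hR hG => ?_)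
        · exact f.map_adj_iff.1 (h (f a) ha (f b) hb (f.injective.ne hab) hR)
        · exact h (f a) ha (f b) hb (f.injective.ne hab) hR (f.map_adj_iff.2 hG) }
  refine (iInf_le _ T).trans (iSup_mono fun t => iSup_le fun x => ?_)
  refine le_trans ?_ (le_iSup (fun x => (reachableParts (P t.castSucc) (R t.succ) r x).encard)
    (f x))
  -- The parts of the restricted partition are preimages of parts.
  have hsub : reachableParts (T.P t.castSucc) (T.R t.succ) r x ⊆
      (f ⁻¹' ·) '' reachableParts (P t.castSucc) (R t.succ) r (f x) := by
    rintro _ ⟨⟨y, rfl⟩, a, ha, hxa⟩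
    exact ⟨{c | P t.castSucc c (f y)}, ⟨⟨f y, rfl⟩, f a, ha, hwithin _ _ _ hxa⟩, rfl⟩
  exact (Set.encard_le_encard hsub).trans (Set.encard_image_le _ _)

open FirstOrder Language

/-- The translation of formulas about expansions of graphs to structures with an additional symbol
for non-adjacency. -/
def fullHom (U : Type) : binaryLanguage U Unit →ᴸ binaryLanguage U Bool where
  onFunction := fun _ f => nomatch f
  onRelation := fun _ R => match R with
    | .unary Y => BinaryRel.unary Y
    | .binary _ => BinaryRel.binary true

/-- The translation of formulas about graphs to expansions of graphs by no unary predicates. -/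
def graphHom : Language.graph →ᴸ binaryLanguage (Fin 0) Unit where
  onFunction := fun _ f => nomatch f
  onRelation := fun _ R => match R with
    | .adj => BinaryRel.binary ()

theorem interpret_fullHom {V : Type u} {k : ℕ} (G : SimpleGraph V) (Y : Fin k → Set V)
    (φ : (binaryLanguage (Fin k) Unit).Formula (Fin 2)) :
    interpret (fullExpansion G Y).toStructure ((fullHom (Fin k)).onFormula φ) =
      interpret (expansion G Y).toStructure φ := by
  let _ := (fullExpansion G Y).toStructure
  let _ := (expansion G Y).toStructure
  have : (fullHom (Fin k)).IsExpansionOn V :=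
    { map_onFunction := fun f => nomatch f
      map_onRelation := by
        intro n R x
        cases R with
        | unary Y => rfl
        | binary R => exact propext (iff_true_right rfl) }
  unfold interpret
  congr 1
  funext a b
  exact propext ((fullHom (Fin k)).realize_onFormula φ)

theorem interpret_graphHom {V : Type u} (G : SimpleGraph V) (Y : Fin 0 → Set V)
    (φ : Language.graph.Formula (Fin 2)) :
    interpret (expansion G Y).toStructure (graphHom.onFormula φ) = interpret G.structure φ := by
  let _ := (expansion G Y).toStructure
  let _ := G.structure
  have : graphHom.IsExpansionOn V :=
    { map_onFunction := fun f => nomatch f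
      map_onRelation := by
        intro n R x
        cases R with
        | adj => rfl }
  unfold interpret
  congr 1
  funext a b
  exact propext (graphHom.realize_onFormula φ)

theorem transduces_interpretClass (φ : Language.graph.Formula (Fin 2))
    (C : Set FiniteGraph.{u}) : Transduces C (interpretClass φ C) := by
  refine ⟨0, graphHom.onFormula φ, ?_⟩
  rintro _ ⟨G, hG, rfl⟩
  refine ⟨G, hG, Fin.elim0, Set.univ, ⟨?_⟩⟩
  rw [interpret_graphHom]
  exact (SimpleGraph.induceUnivIso _).symm

theorem BoundedMergeWidth.of_transduces {C : Set FiniteGraph.{u}} {D : Set FiniteGraph.{w}}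
    (h : Transduces C D) (hC : BoundedMergeWidth C) : BoundedMergeWidth D := by
  intro r
  obtain ⟨k, φ, hφ⟩ := h
  obtain ⟨f, hf⟩ := exists_bound_mergeWidth_interpret.{u, 0} (Fin k) Bool
  let ψ := (fullHom (Fin k)).onFormula φ
  let s := r * (rho 2 (quantifierRank ψ) + 1)
  obtain ⟨n, hn⟩ := ENat.ne_top_iff_exists.1 (hC s).ne
  refine lt_of_le_of_lt (iSup₂_le fun H hH => ?_)
    (ENat.natCast_lt_top (f (quantifierRank ψ) (Nat.card (Fin k) + max 1 n)))
  obtain ⟨G, hG, Y, W, ⟨e⟩⟩ := hφ H hH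
  have hGn : mergeWidth G.graph s ≤ n := by
    rw [hn]
    exact le_iSup₂ (f := fun (G : FiniteGraph) (_ : G ∈ C) => mergeWidth G.graph s) G hG
  have := G.finite
  have hbound := hf (quantifierRank ψ) r _ G.V (fullExpansion G.graph Y) ψ le_rfl
    (mergeWidth_fullExpansion_le_mergeWidth G.graph Y hGn)
  rw [interpret_fullHom] at hbound
  exact (mergeWidth_le_of_embedding ((SimpleGraph.Embedding.induce W).comp e.toEmbedding) r).trans
    hbound

end MergeWidth

open MergeWidth
theorem mainTheorem3 :
    -- closure of bounded merge-width under first-order interpretations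
    (∀ (φ : FirstOrder.Language.graph.Formula (Fin 2)) (C : Set FiniteGraph.{u}),
      BoundedMergeWidth C → BoundedMergeWidth (interpretClass φ C)) ∧
    -- the quantitative version for binary structures over a finite signature
    (∀ (U B : Type v) [Finite U] [Finite B], ∃ f : ℕ → ℕ → ℕ,
      ∀ (q r n : ℕ) (V : Type u) [Finite V] (A : BinaryStructure U B V)
        (φ : (binaryLanguage U B).Formula (Fin 2)), quantifierRank φ ≤ q →
        A.mergeWidth (r * (rho 2 q + 1)) ≤ n →
        mergeWidth (interpret A.toStructure φ) r ≤ f q n) ∧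
    -- closure of bounded merge-width under transductions
    (∀ (C : Set FiniteGraph.{u}) (D : Set FiniteGraph.{w}), Transduces C D →
      BoundedMergeWidth C → BoundedMergeWidth D) := by
  refine ⟨fun φ C => .of_transduces (transduces_interpretClass φ C), fun U B _ _ => ?_,
    fun C D => .of_transduces⟩
  obtain ⟨f, hf⟩ := exists_bound_mergeWidth_interpret.{u, v} U B
  exact ⟨f, fun q r n V _ => hf q r n V⟩
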